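/- **Setting.** Let $k\ge 1$, $l\ge 2$ and $n$ be integers with $l\le\lfloor n/k\rfloor$. The ring has nodes $v_i$, $i\in\mathbb Z/n$, numbered clockwise, and edges $\{v_i,v_{i+1}\}$. There are $l$ robots with pairwise distinct labels from a linearly ordered set; they agree on the clockwise direction (chirality), have no updatable memory, and all start at one node (rooted configuration). Time proceeds in fully synchronous rounds. In each round an adversary removes at most one edge (1-interval connectivity); then every robot sees, for each node, whether it is null (no robot), a singleton (one robot) or a multiplicity node (at least two robots), sees which edge is missing, and knows whether its label is the least one at its node. From this it computes "stay" or a direction, and all robots move simultaneously; a robot cannot cross the missing edge. A node is occupied if it is not null. For a direction $\mathcal D$, $d_{\mathcal D}(x,y)$ is the number of edges from $x$ to $y$ in direction $\mathcal D$. Two occupied nodes of an arc are consecutive if no node of the arc strictly between them is occupied. **Target.** A configuration is dispersed if it has no multiplicity node. It is a target configuration if it is dispersed and $d_{\mathcal D}(x,y)\ge k$ for every direction $\mathcal D$ and all distinct occupied $x,y$ with no occupied node strictly between them in direction $\mathcal D$. It solves distance-$k$-dispersion (D-$k$-D) if every occupied node has exactly one robot, any two distinct occupied nodes have ring distance at least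 $k$, and some two have ring distance exactly $k$. **Chains.** Say that an arc traversed in direction $\mathcal D$ *ends well* if its last node is null, the node $u$ before it is occupied, and every other occupied node $p\ne u$ has $d_{\mathcal D}(u,p)>k$. A chain in direction $\mathcal D$ is an arc in direction $\mathcal D$ with at least two and at most $n$ edges whose second node is a multiplicity node, in which any two consecutive occupied nodes are at distance $k$, and which ends well. A configuration is a chain configuration if it has both a clockwise and a counterclockwise chain. A chain is good if it contains no missing edge, and bad otherwise. **Blocks.** In a dispersed configuration with exactly one ordered pair $(x,y)$ of distinct occupied nodes whose clockwise distance from $x$ to $y$ is less than $k$, the node $x$ is the head. A block in direction $\mathcal D$ is an arc in direction $\mathcal D$, with between $1$ and $n-1$ edges and of maximal length for its start and direction, which starts at a multiplicity node or at the head (its block head), ends well, and satisfies either (a) any two consecutive occupied nodes of the arc are at distance $k$ (*chain block*), or (b) the block head and the next occupied node of the arc are at distance less than $k$, and all later consecutive occupied nodes of the arc are at distance $k$ (*non-chain block*). **Algorithm D-$k$-D DynamicRing.** In a chain configuration the robots execute Spread, otherwise ReconstructChain. *Spread.* Let $\mathcal D$ be: counterclockwise, if both chains are good; the direction of the good chain,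 if exactly one chain is good; the direction in which the edge at the multiplicity node is not missing, if both are bad. On the multiplicity node only the robot with the least label moves, in direction $\mathcal D$. Of the other robots, exactly those on the chain in direction $\mathcal D$, beyond the multiplicity node in that direction, move, in direction $\mathcal D$. *ReconstructChain.* If the missing edge lies in the non-chain block, or in neither block, or there is no missing edge, then all robots on the block head move in the direction of the chain block, and the other robots on the chain block move away from the block head. If the missing edge lies in the chain block, then the robots on the non-chain block other than those on the block head move away from the block head. No other robot moves. **Theorem.** For every choice of root, every labelling, and every choice by the adversary of at most one missing edge in each round: 1. there is $T\le (l-1)k$ such that at the beginning of round $T$ (rounds being numbered from $0$) the configuration is a target configuration and solves D-$k$-D, and the algorithm has terminated: in all rounds $t\ge T$ every robot decides to stay, and all positions remain those at $T$; 2. $(l-1)k<n$, so the algorithm terminates within fewer than $n$ rounds, i.e. in $O(n)$ rounds; 3. whenever the configuration at the beginning of a round $t$ is neither a chain configuration nor a target configuration, it has exactly one chain block and exactly one non-chain block, and at some $t'$ with $t<t'\le t+k-1$ the configuration is a chain configuration or a target configuration. -/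

import Mathlib

namespace DynRing

/-! ### The ring, directions, distances -/

/-- The two directions of the ring, on which all robots agree (chirality). -/
inductive Dir where
  | cw : Dir
  | ccw : Dir

/-- The displacement of one hop; the nodes of the ring are the elements of `ZMod n`, numbered in
clockwise order. -/
def Dir.unit {n : ℕ} : Dir → ZMod n
  | .cw => 1
  | .ccw => -1

/-- The edges of the ring are indexed by `ZMod n`: edge `i` joins node `i` and node `i + 1`.
`edgeAt v D` is the edge at node `v` in direction `D`. -/
def edgeAt {n : ℕ} (v : ZMod n) : Dir → ZMod n
  | .cw => v
  | .ccw => v - 1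

/-- Number of edges from `x` to `y` when walking in direction `D`. -/
def dirDist {n : ℕ} : Dir → ZMod n → ZMod n → ℕ
  | .cw, x, y => (y - x).val
  | .ccw, x, y => (x - y).val

/-- Distance of two nodes in the ring. -/
def ringDist {n : ℕ} (x y : ZMod n) : ℕ := min (dirDist .cw x y) (dirDist .ccw x y)

/-! ### Configurations -/

/-- What a robot sees of a node (weak global multiplicity detection). -/
inductive NodeType where
  | null : NodeType
  | single : NodeType
  | multi : NodeType

/-- A configuration: the type of every node. -/
abbrev Config (n : ℕ) := ZMod n → NodeType

/-- The configuration formed by `l` robots at given positions. -/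
def configOf {n l : ℕ} (pos : Fin l → ZMod n) : Config n := fun v =>
  match (Finset.univ.filter fun r => pos r = v).card with
  | 0 => .null
  | 1 => .single
  | _ + 2 => .multi

/-- Occupied node. -/
def Occ {n : ℕ} (f : Config n) (v : ZMod n) : Prop := f v ≠ .null

/-- Dispersed configuration: no multiplicity node. -/
def Dispersed {n : ℕ} (f : Config n) : Prop := ∀ v, f v ≠ .multi

/-- `x ≠ y` are occupied and no other node of the arc from `x` to `y` in direction `D` is. -/
def Consecutive {n : ℕ} (f : Config n) (D : Dir) (x y : ZMod n) : Prop :=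
  Occ f x ∧ Occ f y ∧ x ≠ y ∧
    ∀ w, Occ f w → ¬ (0 < dirDist D x w ∧ dirDist D x w < dirDist D x y)

/-- Target configuration. -/
def IsTarget {n : ℕ} (k : ℕ) (f : Config n) : Prop :=
  Dispersed f ∧ ∀ D x y, Consecutive f D x y → k ≤ dirDist D x y

/-- The requirements of the distance-`k`-dispersion problem. -/
def SolvesDkD {n : ℕ} (k : ℕ) (f : Config n) : Prop :=
  (∀ v, Occ f v → f v = .single) ∧
  (∀ x y, Occ f x → Occ f y → x ≠ y → k ≤ ringDist x y) ∧
  (∃ x y, Occ f x ∧ Occ f y ∧ x ≠ y ∧ ringDist x y = k)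

/-! ### Arcs, chains and blocks -/

/-- An arc: it starts at `start` and traverses `len` edges in direction `dir`. -/
structure Arc (n : ℕ) where
  start : ZMod n
  dir : Dir
  len : ℕ

/-- The `i`-th node of an arc (the arc consists of the nodes `0, …, len`). -/
def Arc.node {n : ℕ} (A : Arc n) (i : ℕ) : ZMod n := A.start + (i : ZMod n) * A.dir.unit

/-- The edge `e` is one of the edges of the arc. -/
def Arc.HasEdge {n : ℕ} (A : Arc n) (e : ZMod n) : Prop :=
  ∃ i < A.len, e = edgeAt (A.node i) A.dir

/-- The arc contains the missing edge (at most one edge is missing; `none`: no missing edge). -/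
def Arc.HasMissing {n : ℕ} (A : Arc n) (missing : Option (ZMod n)) : Prop :=
  ∃ e, missing = some e ∧ A.HasEdge e

/-- The `a`-th and the `b`-th node are consecutive occupied nodes of the arc, `a < b`. -/
def Arc.Consec {n : ℕ} (f : Config n) (A : Arc n) (a b : ℕ) : Prop :=
  a < b ∧ b ≤ A.len ∧ Occ f (A.node a) ∧ Occ f (A.node b) ∧
    ∀ c, a < c → c < b → ¬ Occ f (A.node c)

/-- The arc ends in a null node that follows an occupied node `u`, and the nearest other occupied
node after `u` in the direction of the arc (if there is one) is at distance more than `k`. -/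
def Arc.EndsWell {n : ℕ} (k : ℕ) (f : Config n) (A : Arc n) : Prop :=
  ¬ Occ f (A.node A.len) ∧ Occ f (A.node (A.len - 1)) ∧
    ∀ p, Occ f p → p ≠ A.node (A.len - 1) → k < dirDist A.dir (A.node (A.len - 1)) p

/-- The arc is a chain in its direction. Its node `0` is the node just before the multiplicity
node, which is its node `1`. (`len ≤ n`: it goes around the ring at most once.) -/
def IsChain {n : ℕ} (k : ℕ) (f : Config n) (A : Arc n) : Prop :=
  2 ≤ A.len ∧ A.len ≤ n ∧ f (A.node 1) = .multi ∧
  (∀ a b, A.Consec f a b → b - a = k) ∧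
  A.EndsWell k f

/-- Chain configuration: there are a clockwise and a counterclockwise chain. -/
def IsChainConfig {n : ℕ} (k : ℕ) (f : Config n) : Prop :=
  ∀ D : Dir, ∃ A : Arc n, A.dir = D ∧ IsChain k f A

/-- `x` is the head: the configuration is dispersed and there is exactly one pair of distinct
occupied nodes at clockwise distance less than `k`; `x` is the first node of that pair. -/
def IsHead {n : ℕ} (k : ℕ) (f : Config n) (x : ZMod n) : Prop :=
  Dispersed f ∧ ∃ y,
    (Occ f x ∧ Occ f y ∧ x ≠ y ∧ dirDist .cw x y < k) ∧
    ∀ x' y', Occ f x' → Occ f y' → x' ≠ y' → dirDist .cw x' y' < k → x' = x ∧ y' = y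

/-- All consecutive occupied nodes of the arc are at distance `k`. -/
def Arc.AllGaps {n : ℕ} (k : ℕ) (f : Config n) (A : Arc n) : Prop :=
  ∀ a b, A.Consec f a b → b - a = k

/-- The first two occupied nodes of the arc, node `0` and node `z`, are at distance less than `k`;
all later consecutive occupied nodes are at distance `k`. -/
def Arc.FirstGapShort {n : ℕ} (k : ℕ) (f : Config n) (A : Arc n) : Prop :=
  ∃ z, A.Consec f 0 z ∧ z < k ∧ ∀ a b, z ≤ a → A.Consec f a b → b - a = k

/-- The defining conditions of a block, apart from the maximality of the arc. -/
def IsBlockArc {n : ℕ} (k : ℕ) (f : Config n) (A : Arc n) : Prop :=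
  1 ≤ A.len ∧ A.len < n ∧ (f A.start = .multi ∨ IsHead k f A.start) ∧
  (A.AllGaps k f ∨ A.FirstGapShort k f) ∧
  A.EndsWell k f

/-- Block in the direction of the arc; its block head is the start of the arc. -/
def IsBlock {n : ℕ} (k : ℕ) (f : Config n) (A : Arc n) : Prop :=
  IsBlockArc k f A ∧ ∀ m, IsBlockArc k f ⟨A.start, A.dir, m⟩ → m ≤ A.len

def IsChainBlock {n : ℕ} (k : ℕ) (f : Config n) (A : Arc n) : Prop :=
  IsBlock k f A ∧ A.AllGaps k f

def IsNonChainBlock {n : ℕ} (k : ℕ) (f : Config n) (A : Arc n) : Prop :=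
  IsBlock k f A ∧ A.FirstGapShort k f

/-! ### The algorithm -/

/-- The chain in direction `D` is good: it contains no missing edge. -/
def GoodChain {n : ℕ} (k : ℕ) (f : Config n) (missing : Option (ZMod n)) (D : Dir) : Prop :=
  ∀ A : Arc n, A.dir = D → IsChain k f A → ¬ A.HasMissing missing

/-- `v` is on the chain in direction `D`, on the side `D` of the multiplicity node. -/
def OnChain {n : ℕ} (k : ℕ) (f : Config n) (D : Dir) (v : ZMod n) : Prop :=
  ∃ A : Arc n, A.dir = D ∧ IsChain k f A ∧ ∃ i, 2 ≤ i ∧ i ≤ A.len ∧ v = A.node i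

open Classical in
/-- The direction in which the subroutine `Spread` moves robots. -/
noncomputable def spreadDir {n : ℕ} (k : ℕ) (f : Config n) (missing : Option (ZMod n)) : Dir :=
  if GoodChain k f missing .cw ∧ GoodChain k f missing .ccw then .ccw
  else if GoodChain k f missing .cw then .cw
  else if GoodChain k f missing .ccw then .ccw
  else if ∃ v, f v = .multi ∧ missing = some (edgeAt v .cw) then .ccw
  else .cw

open Classical in
/-- `Spread`, for a robot at `v`; `least` says whether it has the least label among the robots at
`v`. `none` means: do not move. -/
noncomputable def spread {n : ℕ} (k : ℕ) (f : Config n) (missing : Option (ZMod n))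
    (v : ZMod n) (least : Prop) : Option Dir :=
  if f v = .multi then
    if least then some (spreadDir k f missing) else none
  else
    if OnChain k f (spreadDir k f missing) v then some (spreadDir k f missing) else none

open Classical in
/-- The direction with property `P`, if there is one. -/
noncomputable def theDir (P : Dir → Prop) : Option Dir :=
  if P .cw then some .cw else if P .ccw then some .ccw else none

open Classical in
/-- `ReconstructChain`, for a robot at `v`. -/
noncomputable def reconstructChain {n : ℕ} (k : ℕ) (f : Config n) (missing : Option (ZMod n))
    (v : ZMod n) : Option Dir :=
  let inChainBlock : Prop := ∃ A : Arc n, IsChainBlock k f A ∧ A.HasMissing missing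
  let inNonChainBlock : Prop := ∃ A : Arc n, IsNonChainBlock k f A ∧ A.HasMissing missing
  if ∃ A : Arc n, IsBlock k f A ∧ A.start = v then
    if (¬ inChainBlock ∧ ¬ inNonChainBlock) ∨ inNonChainBlock then
      theDir fun D => ∃ A : Arc n, A.dir = D ∧ IsChainBlock k f A ∧ A.start = v
    else none
  else
    if (¬ inChainBlock ∧ ¬ inNonChainBlock) ∨ inNonChainBlock then
      theDir fun D => ∃ A : Arc n, A.dir = D ∧ IsChainBlock k f A ∧ ∃ i ≤ A.len, v = A.node i
    else if inChainBlock then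
      theDir fun D => ∃ A : Arc n, A.dir = D ∧ IsNonChainBlock k f A ∧ ∃ i ≤ A.len, v = A.node i
    else none

open Classical in
/-- The algorithm `D-k-D DynamicRing`: the move computed by a robot from what it sees. -/
noncomputable def dynamicRing {n : ℕ} (k : ℕ) (f : Config n) (missing : Option (ZMod n))
    (v : ZMod n) (least : Prop) : Option Dir :=
  if IsChainConfig k f then spread k f missing v least else reconstructChain k f missing v

/-! ### Fully synchronous executions -/

/-- The move computed by robot `r` in a round with the given positions and missing edge. -/
noncomputable def action {n l : ℕ} {Λ : Type*} [LinearOrder Λ] (k : ℕ) (label : Fin l → Λ)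
    (missing : Option (ZMod n)) (pos : Fin l → ZMod n) (r : Fin l) : Option Dir :=
  dynamicRing k (configOf pos) missing (pos r) (∀ r', pos r' = pos r → label r ≤ label r')

/-- One fully synchronous round. A robot cannot cross the missing edge. -/
noncomputable def round {n l : ℕ} {Λ : Type*} [LinearOrder Λ] (k : ℕ) (label : Fin l → Λ)
    (missing : Option (ZMod n)) (pos : Fin l → ZMod n) (r : Fin l) : ZMod n :=
  match action k label missing pos r with
  | none => pos r
  | some D => if missing = some (edgeAt (pos r) D) then pos r else pos r + D.unit

/-- The positions at the beginning of round `t`, when all robots start at `root` and the adversary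
removes the edge `missing t` (or no edge) in round `t`. -/
noncomputable def exec {n l : ℕ} {Λ : Type*} [LinearOrder Λ] (k : ℕ) (label : Fin l → Λ)
    (missing : ℕ → Option (ZMod n)) (root : ZMod n) : ℕ → Fin l → ZMod n
  | 0 => fun _ => root
  | t + 1 => round k label (missing t) (exec k label missing root t)

end DynRing

namespace DynRing

/-! ### Integer coordinates on the ring -/

/-! The execution is described by a few integers. Seen from a suitable centre, `c` robots share one
node, `b` robots lie ahead, the first at distance `j ≤ k`, and `a` robots lie behind, all other gaps
being `k` (`Placed`). The gap that closes the ring exceeds `k` until the target is reached, because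
`l * k ≤ n`; hence chains and blocks can be read off from the offsets, each being the only arc of
its kind.

If `j = k` and `2 ≤ c`, the configuration is a chain configuration. `Spread` detaches one robot and
pushes one side along with it, so `(c, k, b)` becomes `(c - 1, 1, b + 1)`, up to exchanging the
sides (`Placed.round_spread`). If `j < k`, the short gap separates the robots into two groups, and
`ReconstructChain` moves one of them away from the other by one edge, so `j` becomes `j + 1`
(`Placed.round_reconstruct`). The adversary cannot interfere: the edges that the two possible groups
of movers would cross are disjoint in the second case, and in the first the two chains overlap only
in the edges at the multiplicity node, so the chosen group is never blocked.

Thus every round stretches the occupied arc by exactly one edge, which gives `t + (k - j) + c * k =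
l * k` (`PlacedAt.time`). At `t = (l - 1) * k` this forces `c = 1` and `j = k`, a target
configuration in which nobody moves; and from `j < k` it takes `k - j` rounds to regain a chain or
target configuration. -/

/-- The opposite direction. -/
def Dir.opp : Dir → Dir
  | .cw => .ccw
  | .ccw => .cw

theorem Dir.eq_or_eq_opp (D E : Dir) : E = D ∨ E = D.opp := by
  cases D <;> cases E <;> simp [Dir.opp]

theorem Dir.opp_ne (D : Dir) : D.opp ≠ D := by cases D <;> simp [Dir.opp]

theorem Dir.unit_opp {n : ℕ} (D : Dir) : (D.opp.unit : ZMod n) = -D.unit := by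
  cases D <;> simp [Dir.opp, Dir.unit]

theorem Dir.unit_mul_self {n : ℕ} (D : Dir) : (D.unit : ZMod n) * D.unit = 1 := by
  cases D <;> simp [Dir.unit]

/-- The node reached from `m` by `t` hops in direction `D`. -/
def pt {n : ℕ} (m : ZMod n) (D : Dir) (t : ℤ) : ZMod n := m + (t : ZMod n) * D.unit

section Coordinates

variable {n : ℕ} {m : ZMod n} {D : Dir}

@[simp] theorem pt_zero : pt m D 0 = m := by simp [pt]

theorem pt_pt (s t : ℤ) : pt (pt m D s) D t = pt m D (s + t) := by
  simp only [pt]; push_cast; ring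

theorem pt_opp (t : ℤ) : pt m D.opp t = pt m D (-t) := by
  simp only [pt, Dir.unit_opp]; push_cast; ring

theorem pt_add_unit (t : ℤ) : pt m D t + D.unit = pt m D (t + 1) := by
  simp only [pt]; push_cast; ring

theorem pt_eq_iff_dvd {s t : ℤ} : pt m D s = pt m D t ↔ (n : ℤ) ∣ t - s := by
  rw [← ZMod.intCast_eq_intCast_iff_dvd_sub]
  constructor
  · intro h
    have h' : (s : ZMod n) * (D.unit : ZMod n) = t * (D.unit : ZMod n) := add_left_cancel h
    have h2 := congrArg (· * (D.unit : ZMod n)) h'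
    simpa only [mul_assoc, Dir.unit_mul_self, mul_one] using h2
  · intro h
    simp [pt, h]

/-- The device that turns equations between nodes into equations between integers; the hypotheses
say that the offsets fit into one turn of the ring. -/
theorem pt_injOn {s t : ℤ} (h : pt m D s = pt m D t) (h1 : s - t < n) (h2 : t - s < n) :
    s = t := by
  have h3 := Int.eq_zero_of_abs_lt_dvd (pt_eq_iff_dvd.1 h) (abs_lt.2 ⟨by omega, h2⟩)
  omega

theorem node_eq_pt (A : Arc n) (i : ℕ) : A.node i = pt A.start A.dir i := by
  simp [Arc.node, pt]

theorem dirDist_pt [NeZero n] (s t : ℤ) : (dirDist D (pt m D s) (pt m D t) : ℤ) = (t - s) % n := by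
  rw [← ZMod.val_intCast]
  cases D
  · simp [dirDist, pt, Dir.unit]
  · simp only [dirDist, pt, Dir.unit]
    congr 2; push_cast; ring

theorem dirDist_pt_of_le [NeZero n] {s t : ℤ} (h : s ≤ t) (h' : t - s < n) :
    (dirDist D (pt m D s) (pt m D t) : ℤ) = t - s := by
  rw [dirDist_pt, Int.emod_eq_of_lt (by omega) h']

theorem dirDist_pt_of_lt [NeZero n] {s t : ℤ} (h : t < s) (h' : s - t < n) :
    (dirDist D (pt m D s) (pt m D t) : ℤ) = n + t - s := by
  rw [dirDist_pt, ← Int.add_emod_right, Int.emod_eq_of_lt (by omega) (by omega)]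
  ring

/-- Edges are undirected: the edge behind a node is the edge ahead of its predecessor. -/
theorem edgeAt_opp (t : ℤ) : edgeAt (pt m D t) D.opp = edgeAt (pt m D (t - 1)) D := by
  cases D <;> simp [edgeAt, pt, Dir.opp, Dir.unit] <;> ring

theorem edgeAt_injective {v w : ZMod n} (h : edgeAt v D = edgeAt w D) : v = w := by
  cases D <;> simpa [edgeAt] using h

end Coordinates

/-! ### Offsets of the occupied nodes -/

/-- The offset `0` and `b` further offsets, the first one `j`, the others in steps of `k`. -/
def Side (k j b : ℕ) (t : ℤ) : Prop := t = 0 ∨ ∃ i : ℕ, i < b ∧ t = j + i * k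

/-- The largest offset of `Side k j b`. -/
def reach (k j : ℕ) : ℕ → ℕ
  | 0 => 0
  | b + 1 => j + b * k

/-- Offsets in two directions from a common origin. -/
def Offs (k j b j' a : ℕ) (t : ℤ) : Prop := Side k j b t ∨ Side k j' a (-t)

section Offsets

variable {k j b j' a : ℕ} {s t : ℤ}

theorem Side.nonneg (h : Side k j b t) : 0 ≤ t := by
  rcases h with rfl | ⟨i, -, rfl⟩ <;> positivity

theorem Side.le_reach (h : Side k j b t) : t ≤ reach k j b := by
  rcases h with rfl | ⟨i, hi, rfl⟩
  · positivity
  · obtain ⟨b, rfl⟩ := Nat.exists_eq_succ_of_ne_zero (Nat.ne_zero_of_lt hi)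
    have : i * k ≤ b * k := Nat.mul_le_mul_right _ (by omega)
    simp only [reach]; push_cast; zify at this; linarith

theorem side_reach : Side k j b (reach k j b) := by
  cases b with
  | zero => left; rfl
  | succ b => right; exact ⟨b, by omega, by simp [reach]⟩

theorem Side.exists_next (hj : 1 ≤ j) (hjk : j ≤ k) (h : Side k j b t) (ht : t ≠ reach k j b) :
    ∃ s, Side k j b s ∧ t < s ∧ s ≤ t + k := by
  rcases h with rfl | ⟨i, hi, rfl⟩
  · cases b with
    | zero => simp [reach] at ht
    | succ b => exact ⟨j, Or.inr ⟨0, by omega, by simp⟩, by omega, by omega⟩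
  · refine ⟨j + (i + 1 : ℕ) * k, Or.inr ⟨i + 1, ?_, rfl⟩, ?_, ?_⟩
    · rcases Nat.lt_or_ge (i + 1) b with h | h
      · exact h
      · obtain rfl : b = i + 1 := by omega
        simp [reach] at ht
    · push_cast; linarith
    · push_cast; linarith

theorem Side.exists_prev (hj : 1 ≤ j) (hjk : j ≤ k) (h : Side k j b t) (ht : t ≠ 0) :
    ∃ s, Side k j b s ∧ s < t ∧ t ≤ s + k := by
  rcases h with rfl | ⟨i, hi, rfl⟩
  · exact absurd rfl ht
  · cases i with
    | zero => exact ⟨0, Or.inl rfl, by simp; omega, by simp; omega⟩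
    | succ i =>
      refine ⟨j + i * k, Or.inr ⟨i, by omega, rfl⟩, ?_, ?_⟩ <;> push_cast <;> linarith

theorem Side.gap (hj : 1 ≤ j) (hs : Side k j b s) (ht : Side k j b t) (hst : s < t) :
    s + k ≤ t ∨ (s = 0 ∧ t = j) := by
  rcases ht with rfl | ⟨i, hi, rfl⟩
  · have := hs.nonneg; omega
  · rcases hs with rfl | ⟨i', hi', rfl⟩
    · cases i with
      | zero => right; simp
      | succ i => left; push_cast; nlinarith
    · left
      have : i' < i := by
        by_contra h
        have h1 : i * k ≤ i' * k := Nat.mul_le_mul_right _ (by omega)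
        zify at h1; linarith
      have h1 : (i' + 1) * k ≤ i * k := Nat.mul_le_mul_right _ this
      zify at h1; linarith

theorem Side.eq_zero_or_le (h : Side k j b t) : t = 0 ∨ (j : ℤ) ≤ t := by
  rcases h with rfl | ⟨i, -, rfl⟩
  · exact Or.inl rfl
  · right; have : (0 : ℤ) ≤ i * k := by positivity
    linarith

theorem offs_zero : Offs k j b j' a 0 := Or.inl (Or.inl rfl)

theorem Offs.symm (h : Offs k j b j' a t) : Offs k j' a j b (-t) := by
  rcases h with h | h
  · right; simpa using h
  · left; exact h

theorem offs_reach : Offs k j b j' a (reach k j b) := Or.inl side_reach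

theorem Offs.le_reach (h : Offs k j b j' a t) : t ≤ reach k j b := by
  rcases h with h | h
  · exact h.le_reach
  · have := h.nonneg; omega

theorem Offs.neg_reach_le (h : Offs k j b j' a t) : -(reach k j' a : ℤ) ≤ t := by
  have := h.symm.le_reach; omega

theorem Offs.exists_next (hj : 1 ≤ j) (hjk : j ≤ k) (hj' : 1 ≤ j') (hjk' : j' ≤ k)
    (h : Offs k j b j' a t) (ht : t ≠ reach k j b) :
    ∃ s, Offs k j b j' a s ∧ t < s ∧ s ≤ t + k := by
  by_cases h0 : 0 ≤ t
  · have h1 : Side k j b t := by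
      rcases h with h | h
      · exact h
      · left; have := h.nonneg; omega
    obtain ⟨s, hs, h2⟩ := h1.exists_next hj hjk ht
    exact ⟨s, Or.inl hs, h2⟩
  · have h1 : Side k j' a (-t) := by
      rcases h with h | h
      · have := h.nonneg; omega
      · exact h
    obtain ⟨s, hs, h2, h3⟩ := h1.exists_prev hj' hjk' (by omega)
    exact ⟨-s, Or.inr (by simpa using hs), by omega, by omega⟩

/-- Only the two gaps next to the origin can be short. Offsets on opposite sides of the origin
differ by at least `j + j'`, which is at least `k` by `hk`. -/
theorem Offs.gap (hj : 1 ≤ j) (hj' : 1 ≤ j') (hk : j = k ∨ j' = k)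
    (hs : Offs k j b j' a s) (ht : Offs k j b j' a t) (hst : s < t) :
    s + k ≤ t ∨ (s = 0 ∧ t = j) ∨ (s = -j' ∧ t = 0) := by
  rcases hs with hs | hs <;> rcases ht with ht | ht
  · rcases hs.gap hj ht hst with h | h
    · exact Or.inl h
    · exact Or.inr (Or.inl h)
  · have := hs.nonneg; have := ht.nonneg; omega
  · rcases hs.eq_zero_or_le with h | h
    · have hs' : Side k j b s := Or.inl (by omega)
      rcases hs'.gap hj ht hst with h | h
      · exact Or.inl h
      · exact Or.inr (Or.inl h)
    · rcases ht.eq_zero_or_le with h1 | h1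
      · have ht' : Side k j' a (-t) := Or.inl (by omega)
        rcases ht'.gap hj' hs (by omega) with h2 | h2
        · left; omega
        · right; right; omega
      · left; omega
  · rcases ht.gap hj' hs (by omega) with h2 | h2
    · left; omega
    · right; right; omega

end Offsets

/-! ### Configurations seen from a centre -/

/-- Seen from `m`, the occupied nodes are `m` itself, `b` nodes in direction `D` (the first one at
distance `j`) and `a` nodes in the other direction (the first one at distance `j'`), at further
gaps `k`; beyond them there is a gap of more than `k`. -/
structure Shape {n : ℕ} (k : ℕ) (f : Config n) (D : Dir) (m : ZMod n) (j b j' a : ℕ) : Prop where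
  occ : ∀ v, Occ f v ↔ ∃ t, Offs k j b j' a t ∧ v = pt m D t
  width : reach k j b + reach k j' a + k < n
  one_le : 1 ≤ j
  le : j ≤ k
  one_le' : 1 ≤ j'
  le' : j' ≤ k
  full : j = k ∨ j' = k

namespace Shape

variable {n k j b j' a : ℕ} {f : Config n} {D : Dir} {m : ZMod n}

/-- Keeping both first gaps `j` and `j'` as parameters makes the structure invariant under
reflection, so results about direction `D` also serve for the opposite one. -/
theorem symm (h : Shape k f D m j b j' a) : Shape k f D.opp m j' a j b where
  occ v := by
    rw [h.occ]
    constructor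
    · rintro ⟨t, ht, rfl⟩
      exact ⟨-t, ht.symm, by rw [pt_opp, neg_neg]⟩
    · rintro ⟨t, ht, rfl⟩
      exact ⟨-t, ht.symm, pt_opp t⟩
  width := by have := h.width; omega
  one_le := h.one_le'
  le := h.le'
  one_le' := h.one_le
  le' := h.le
  full := h.full.symm

theorem occ_of_offs (h : Shape k f D m j b j' a) {t : ℤ} (ht : Offs k j b j' a t) :
    Occ f (pt m D t) := (h.occ _).2 ⟨t, ht, rfl⟩

theorem occ_pt_iff (h : Shape k f D m j b j' a) {t : ℤ} (h1 : -1 ≤ t)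
    (h2 : t ≤ reach k j b + k) : Occ f (pt m D t) ↔ Offs k j b j' a t := by
  refine ⟨fun ho => ?_, h.occ_of_offs⟩
  obtain ⟨s, hs, hst⟩ := (h.occ _).1 ho
  have := hs.le_reach
  have := hs.neg_reach_le
  have := h.width
  have := h.one_le
  have := h.le
  rwa [pt_injOn hst (by omega) (by omega)]

theorem two_le (h : Shape k f D m j b j' a) : 2 ≤ n := by
  have := h.width; have := h.one_le; have := h.le; omega

/-- The only occupied node without an occupied node at distance at most `k` in direction `D` is
the last one. -/
theorem endsWell_iff (h : Shape k f D m j b j' a) {A : Arc n} (hA : A.dir = D) (hl : 1 ≤ A.len) :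
    A.EndsWell k f ↔ A.node (A.len - 1) = pt m D (reach k j b) := by
  have hn := h.two_le
  have : NeZero n := ⟨by omega⟩
  have hw := h.width
  have hj1 := h.one_le
  have hj2 := h.le
  have hnext : A.node A.len = pt (A.node (A.len - 1)) D 1 := by
    rw [node_eq_pt, node_eq_pt, hA, pt_pt]
    congr 1; omega
  constructor
  · rintro ⟨-, h2, h3⟩
    obtain ⟨t, ht, htA⟩ := (h.occ _).1 h2
    by_contra hne
    have htr : t ≠ reach k j b := by rintro rfl; exact hne htA
    obtain ⟨s, hs, hs1, hs2⟩ := ht.exists_next h.one_le h.le h.one_le' h.le' htr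
    have hd := dirDist_pt_of_le (m := m) (D := D) hs1.le (by omega)
    rw [htA, hA] at h3
    have h4 := h3 (pt m D s) (h.occ_of_offs hs) fun h => by
      have := pt_injOn h (by omega) (by omega)
      omega
    omega
  · intro he
    refine ⟨?_, ?_, ?_⟩
    · rw [hnext, he, pt_pt, h.occ_pt_iff (by omega) (by omega)]
      intro h4
      have := h4.le_reach
      omega
    · rw [he]
      exact h.occ_of_offs offs_reach
    · rw [he, hA]
      intro p hp hpe
      obtain ⟨t, ht, rfl⟩ := (h.occ _).1 hp
      have h1 := ht.le_reach
      have h2 := ht.neg_reach_le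
      have h3 : t ≠ reach k j b := by rintro rfl; exact hpe rfl
      have h4 := dirDist_pt_of_lt (m := m) (D := D) (show t < reach k j b by omega) (by omega)
      omega

/-- Consecutive occupied nodes of an arc that starts at offset `-1` or `0`. -/
theorem consec_gap (h : Shape k f D m j b j' a) {A : Arc n} {s : ℤ} (hA : A.dir = D)
    (hs : A.start = pt m D s) (hs1 : -1 ≤ s) (hl : A.len + s ≤ reach k j b + k) {x y : ℕ}
    (hc : A.Consec f x y) :
    y - x = k ∨ (s + x = 0 ∧ s + y = j) ∨ (s + x = -j' ∧ s + y = 0) := by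
  obtain ⟨hxy, hy, ox, oy, hno⟩ := hc
  have hnode (i : ℕ) : A.node i = pt m D (s + i) := by rw [node_eq_pt, hA, hs, pt_pt]
  rw [hnode, h.occ_pt_iff (by omega) (by omega)] at ox oy
  have hyr := oy.le_reach
  obtain ⟨t, ht, ht1, ht2⟩ := ox.exists_next h.one_le h.le h.one_le' h.le' (by omega)
  -- Otherwise the next occupied offset `t` would be a node of the arc strictly between the two
  -- consecutive ones.
  have hty : s + y ≤ t := by
    by_contra hlt
    refine hno (t - s).toNat (by omega) (by omega) ?_
    rw [hnode, show s + ((t - s).toNat : ℤ) = t by omega]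
    exact h.occ_of_offs ht
  rcases ox.gap h.one_le h.one_le' h.full oy (by omega) with h1 | h1
  · left; omega
  · exact Or.inr h1

theorem center_occ (h : Shape k f D m j b j' a) : Occ f m := by
  simpa using h.occ_of_offs offs_zero

/-! ### Chains -/

/-- The multiplicity node fixes the start, `endsWell_iff` fixes the last occupied node, and the
bound `A.len ≤ n` excludes a further turn around the ring. -/
theorem isChain_iff (h : Shape k f D m k b k a) (hm : ∀ v, f v = .multi ↔ v = m) {A : Arc n}
    (hA : A.dir = D) : IsChain k f A ↔ A = ⟨pt m D (-1), D, reach k k b + 2⟩ := by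
  have hn := h.two_le
  have hw := h.width
  have hk := h.one_le
  constructor
  · rintro ⟨h1, h2, h3, -, h5⟩
    rw [hm, node_eq_pt, hA] at h3
    have hs : A.start = pt m D (-1) := by rw [← h3, pt_pt]; simp
    rw [h.endsWell_iff hA (by omega), node_eq_pt, hs, hA, pt_pt] at h5
    have h6 := pt_injOn h5 (by omega) (by omega)
    have h7 : A.len = reach k k b + 2 := by omega
    cases A
    simp_all
  · rintro rfl
    refine ⟨by simp, by simp only; omega, ?_, ?_, ?_⟩
    · rw [hm, node_eq_pt, pt_pt]; simp
    · intro x y hc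
      have h1 := hc.1
      rcases h.consec_gap rfl rfl (le_refl _) (by simp only; push_cast; omega) hc with
        h2 | h2 | h2
      · exact h2
      · omega
      · omega
    · rw [h.endsWell_iff rfl (by simp), node_eq_pt, pt_pt]
      congr 1
      simp only; push_cast; omega

theorem isChainConfig (h : Shape k f D m k b k a) (hm : ∀ v, f v = .multi ↔ v = m) :
    IsChainConfig k f := by
  intro E
  rcases D.eq_or_eq_opp E with rfl | rfl
  · exact ⟨_, rfl, (h.isChain_iff hm rfl).2 rfl⟩
  · exact ⟨_, rfl, (h.symm.isChain_iff hm rfl).2 rfl⟩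

/-- The index `s` of the centre is `1` in chains, which start one node earlier, and `0` in blocks.
-/
theorem consec_first (h : Shape k f D m j b k a) (hb : 1 ≤ b) {A : Arc n} {s : ℕ}
    (hA : A.dir = D) (hs : A.node s = m) (hl : s + j ≤ A.len) : A.Consec f s (s + j) := by
  have hj := h.one_le
  have hnode (i : ℕ) : A.node (s + i) = pt m D i := by
    rw [← hs, node_eq_pt, node_eq_pt, hA, pt_pt]; push_cast; rfl
  have hoj : Offs k j b k a j := Or.inl (Or.inr ⟨0, hb, by simp⟩)
  have hr := hoj.le_reach
  refine ⟨by omega, hl, hs ▸ h.center_occ, ?_, ?_⟩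
  · rw [hnode]
    exact h.occ_of_offs hoj
  · intro c hc1 hc2
    obtain ⟨i, rfl⟩ := Nat.exists_eq_add_of_lt hc1
    rw [add_assoc, hnode, h.occ_pt_iff (by omega) (by omega)]
    intro hc
    have := h.le
    rcases offs_zero.gap h.one_le h.one_le' h.full hc (by omega) <;> omega

theorem not_isChainConfig (h : Shape k f D m j b k a) (hb : 1 ≤ b) (hj : j < k)
    (hm : ∀ v, f v = .multi → v = m) : ¬ IsChainConfig k f := by
  intro hcc
  have hn := h.two_le
  have hw := h.width
  obtain ⟨A, hA, h1, h2, h3, h4, h5⟩ := hcc D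
  have h6 := hm _ h3
  rw [h.endsWell_iff hA (by omega)] at h5
  have hnode : A.node (A.len - 1) = pt m D (A.len - 2 : ℕ) := by
    rw [← h6, node_eq_pt, node_eq_pt, hA, pt_pt]; congr 1; omega
  rw [hnode] at h5
  have h7 := pt_injOn h5 (by omega) (by omega)
  have hoj : Offs k j b k a j := Or.inl (Or.inr ⟨0, hb, by simp⟩)
  have hr := hoj.le_reach
  have h8 := h4 _ _ (h.consec_first hb hA h6 (by omega))
  omega

/-! ### Blocks -/

theorem allGaps_block (h : Shape k f D m k b j' a) :
    Arc.AllGaps k f ⟨m, D, reach k k b + 1⟩ := by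
  intro x y hc
  have h1 := hc.1
  have := h.one_le'
  have := h.one_le
  rcases h.consec_gap (s := 0) rfl (by simp) (by omega) (by simp only; push_cast; omega) hc with
    h2 | h2 | h2 <;> omega

theorem firstGapShort_block (h : Shape k f D m j b k a) (hb : 1 ≤ b) (hj : j < k) :
    Arc.FirstGapShort k f ⟨m, D, reach k j b + 1⟩ := by
  have hoj : Offs k j b k a j := Or.inl (Or.inr ⟨0, hb, by simp⟩)
  have hr := hoj.le_reach
  have hj1 := h.one_le
  refine ⟨j, ?_, hj, ?_⟩
  · simpa using h.consec_first (A := ⟨m, D, reach k j b + 1⟩) (s := 0) hb rfl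
      (by simp [node_eq_pt]) (by simp only; omega)
  · intro x y hx hc
    rcases h.consec_gap (s := 0) rfl (by simp) (by omega) (by simp only; push_cast; omega) hc with
      h2 | h2 | h2 <;> omega

theorem isBlockArc_iff (h : Shape k f D m j b j' a)
    (hs : ∀ v, f v = .multi ∨ IsHead k f v ↔ v = m)
    (hg : Arc.AllGaps k f ⟨m, D, reach k j b + 1⟩ ∨ Arc.FirstGapShort k f ⟨m, D, reach k j b + 1⟩)
    {A : Arc n} (hA : A.dir = D) : IsBlockArc k f A ↔ A = ⟨m, D, reach k j b + 1⟩ := by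
  have hn := h.two_le
  have hw := h.width
  have hk := h.one_le
  have hjk := h.le
  constructor
  · rintro ⟨h1, h2, h3, -, h5⟩
    rw [hs] at h3
    rw [h.endsWell_iff hA h1, node_eq_pt, h3, hA] at h5
    have h6 := pt_injOn h5 (by omega) (by omega)
    have h7 : A.len = reach k j b + 1 := by omega
    cases A
    simp_all
  · rintro rfl
    refine ⟨by simp, by simp only; omega, (hs _).2 rfl, hg, ?_⟩
    rw [h.endsWell_iff rfl (by simp), node_eq_pt]
    simp

/-- Both ends of a block arc are forced, so only one length is possible and maximality is automatic.
-/
theorem isBlock_iff (h : Shape k f D m j b j' a)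
    (hs : ∀ v, f v = .multi ∨ IsHead k f v ↔ v = m)
    (hg : Arc.AllGaps k f ⟨m, D, reach k j b + 1⟩ ∨ Arc.FirstGapShort k f ⟨m, D, reach k j b + 1⟩)
    {A : Arc n} (hA : A.dir = D) : IsBlock k f A ↔ A = ⟨m, D, reach k j b + 1⟩ := by
  rw [IsBlock, h.isBlockArc_iff hs hg hA]
  refine ⟨fun h => h.1, ?_⟩
  rintro rfl
  refine ⟨rfl, fun l hl => ?_⟩
  rw [h.isBlockArc_iff hs hg rfl] at hl
  simp only [Arc.mk.injEq, true_and] at hl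
  exact hl.le

variable (h : Shape k f D m j b k a) (hs : ∀ v, f v = .multi ∨ IsHead k f v ↔ v = m)
  (hb : 1 ≤ b) (hj : j < k)

include h hs hb hj

theorem isBlock_iff_or (A : Arc n) :
    IsBlock k f A ↔ A = ⟨m, D, reach k j b + 1⟩ ∨ A = ⟨m, D.opp, reach k k a + 1⟩ := by
  rcases D.eq_or_eq_opp A.dir with hA | hA
  · rw [h.isBlock_iff hs (Or.inr (h.firstGapShort_block hb hj)) hA]
    refine ⟨Or.inl, ?_⟩
    rintro (h1 | rfl)
    · exact h1
    · exact absurd hA D.opp_ne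
  · rw [h.symm.isBlock_iff hs (Or.inl h.symm.allGaps_block) hA]
    refine ⟨Or.inr, ?_⟩
    rintro (rfl | h1)
    · exact absurd hA.symm D.opp_ne
    · exact h1

theorem isChainBlock_iff (A : Arc n) :
    IsChainBlock k f A ↔ A = ⟨m, D.opp, reach k k a + 1⟩ := by
  rw [IsChainBlock, h.isBlock_iff_or hs hb hj]
  constructor
  · rintro ⟨rfl | h1, h2⟩
    · have hoj : Offs k j b k a j := Or.inl (Or.inr ⟨0, hb, by simp⟩)
      have hr := hoj.le_reach
      have := h2 _ _ (h.consec_first (s := 0) hb rfl (by simp [node_eq_pt]) (by simp only; omega))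
      omega
    · exact h1
  · rintro rfl
    exact ⟨Or.inr rfl, h.symm.allGaps_block⟩

theorem isNonChainBlock_iff (A : Arc n) :
    IsNonChainBlock k f A ↔ A = ⟨m, D, reach k j b + 1⟩ := by
  rw [IsNonChainBlock, h.isBlock_iff_or hs hb hj]
  constructor
  · rintro ⟨h1 | rfl, z, hz, hzk, -⟩
    · exact h1
    · have := h.symm.allGaps_block _ _ hz
      omega
  · rintro rfl
    exact ⟨Or.inl rfl, h.firstGapShort_block hb hj⟩

end Shape

namespace Shape

variable {n k j b j' a : ℕ} {f : Config n} {D : Dir} {m : ZMod n} {missing : Option (ZMod n)}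

/-! ### The moves of `Spread` -/

theorem onChain_iff (h : Shape k f D m k b k a) (hm : ∀ v, f v = .multi ↔ v = m) {t : ℤ}
    (ht : Offs k k b k a t) : OnChain k f D (pt m D t) ↔ 0 < t := by
  have hw := h.width
  have hk := h.one_le
  have h1 := ht.le_reach
  have h2 := ht.neg_reach_le
  constructor
  · rintro ⟨A, hA, hc, i, hi, hi', hv⟩
    rw [h.isChain_iff hm hA] at hc
    subst hc
    rw [node_eq_pt, pt_pt] at hv
    simp only at hi'
    have := pt_injOn hv (by omega) (by omega)
    omega
  · intro h0
    refine ⟨_, rfl, (h.isChain_iff hm rfl).2 rfl, (t + 1).toNat, by omega, by simp only; omega, ?_⟩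
    rw [node_eq_pt, pt_pt]
    congr 1; omega

/-- The two edges span the offsets from `s` to `s + 1` and from `-t - 1` to `-t`. They agree only if
`s + t + 1` is a multiple of `n`, but it lies strictly between `0` and `n`. -/
theorem edgeAt_ne (h : Shape k f D m j b j' a) {s t : ℤ} (hs : s ≤ reach k j b)
    (ht : t ≤ reach k j' a) (hst : 0 ≤ s + t) :
    edgeAt (pt m D s) D ≠ edgeAt (pt m D.opp t) D.opp := by
  have hw := h.width
  have hk := h.one_le
  have hjk := h.le
  intro he
  rw [pt_opp, edgeAt_opp] at he
  have := pt_injOn (edgeAt_injective he) (by omega) (by omega)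
  omega

theorem goodChain_iff (h : Shape k f D m k b k a) (hm : ∀ v, f v = .multi ↔ v = m) :
    GoodChain k f missing D ↔
      ∀ t : ℤ, -1 ≤ t → t ≤ reach k k b → missing ≠ some (edgeAt (pt m D t) D) := by
  constructor
  · intro hg t ht ht' he
    refine hg _ rfl ((h.isChain_iff hm rfl).2 rfl) ⟨_, he, (t + 1).toNat, by simp only; omega, ?_⟩
    rw [node_eq_pt, pt_pt]
    congr 2; omega
  · rintro hg A hA hc ⟨e, he, i, hi, hie⟩
    rw [h.isChain_iff hm hA] at hc
    subst hc
    rw [node_eq_pt, pt_pt] at hie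
    simp only at hi
    exact hg (-1 + i) (by omega) (by omega) (by rw [he, hie])

/-- If both chains are bad, then an edge at the multiplicity node is missing. -/
theorem missing_center (h : Shape k f D m k b k a) (hm : ∀ v, f v = .multi ↔ v = m)
    (h1 : ¬ GoodChain k f missing D) (h2 : ¬ GoodChain k f missing D.opp) :
    missing = some (edgeAt m D) ∨ missing = some (edgeAt m D.opp) := by
  have hw := h.width
  have hk := h.one_le
  rw [h.goodChain_iff hm] at h1
  rw [h.symm.goodChain_iff hm] at h2
  push Not at h1 h2
  obtain ⟨s, hs1, hs2, hs3⟩ := h1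
  obtain ⟨t, ht1, ht2, ht3⟩ := h2
  have he : edgeAt (pt m D s) D = edgeAt (pt m D.opp t) D.opp := by
    rw [hs3] at ht3; exact Option.some.inj ht3
  rw [pt_opp, edgeAt_opp] at he
  have := pt_injOn (edgeAt_injective he) (by omega) (by omega)
  -- Here `s + t = -1` with both at least `-1`: each chain starts one node behind the centre, so the
  -- two share just the edges at the centre.
  rcases (show s = 0 ∨ t = 0 by omega) with rfl | rfl
  · left; simpa using hs3
  · right; simpa using ht3

theorem spread_not_blocked (h : Shape k f D m k b k a) (hm : ∀ v, f v = .multi ↔ v = m)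
    (hD : spreadDir k f missing = D) {t : ℤ} (ht : 0 ≤ t) (ht' : t ≤ reach k k b) :
    missing ≠ some (edgeAt (pt m D t) D) := by
  have good (hg : GoodChain k f missing D) : missing ≠ some (edgeAt (pt m D t) D) :=
    (h.goodChain_iff hm).1 hg t (by omega) ht'
  have bad (he : missing = some (edgeAt m D.opp)) : missing ≠ some (edgeAt (pt m D t) D) := by
    rw [he]
    intro h3
    refine h.edgeAt_ne (s := t) (t := 0) ht' (by omega) (by omega) ?_
    rw [pt_zero]
    exact (Option.some.inj h3).symm
  by_cases hg : GoodChain k f missing D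
  · exact good hg
  by_cases hg' : GoodChain k f missing D.opp
  -- A good opposite chain would have been chosen instead of the bad one.
  · exfalso
    cases D <;> simp_all [spreadDir, Dir.opp]
  · apply bad
    have hmc := h.missing_center hm hg hg'
    have hex : (∃ v, f v = .multi ∧ missing = some (edgeAt v .cw)) ↔
        missing = some (edgeAt m .cw) := by simp [hm]
    cases D
    · simp only [Dir.opp] at *
      simp only [spreadDir, hg, hg', hex, false_and, if_false] at hD
      by_cases h1 : missing = some (edgeAt m .cw)
      · simp [h1] at hD
      · exact hmc.resolve_left h1
    · simp only [Dir.opp] at *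
      simp only [spreadDir, hg, hg', hex, false_and, if_false] at hD
      by_contra h1
      simp [h1] at hD

open Classical in
theorem spread_eq (h : Shape k f D m k b k a) (hm : ∀ v, f v = .multi ↔ v = m)
    (hD : spreadDir k f missing = D) {t : ℤ} (ht : Offs k k b k a t) (least : Prop) :
    spread k f missing (pt m D t) least = if 0 < t ∨ t = 0 ∧ least then some D else none := by
  have hw := h.width
  have h1 := ht.le_reach
  have h2 := ht.neg_reach_le
  have h0 : pt m D t = m ↔ t = 0 := by
    refine ⟨fun he => ?_, fun he => by simp [he]⟩
    rw [← pt_zero (m := m) (D := D), pt_pt, pt_zero] at he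
    exact pt_injOn (m := m) (D := D) (by simpa using he) (by omega) (by omega)
  rw [spread, hm, h0, hD, h.onChain_iff hm ht]
  by_cases h3 : t = 0 <;> simp [h3]

/-! ### The moves of `ReconstructChain` -/

/-- At most one direction is eligible, so the preference of `theDir` for clockwise has no effect. -/
theorem theDir_eq {P : Dir → Prop} {Q : Prop} [Decidable Q] {E : Dir}
    (hP : ∀ D, P D ↔ D = E ∧ Q) : theDir P = if Q then some E else none := by
  cases E <;> by_cases hQ : Q <;> simp [theDir, hP, hQ]

theorem exists_block_iff {P : Arc n → Prop} {A : Arc n} (hP : ∀ B, P B ↔ B = A)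
    (R : Arc n → Prop) (E : Dir) :
    (∃ B : Arc n, B.dir = E ∧ P B ∧ R B) ↔ E = A.dir ∧ R A := by
  constructor
  · rintro ⟨B, h1, h2, h3⟩
    obtain rfl := (hP B).1 h2
    exact ⟨h1.symm, h3⟩
  · rintro ⟨h1, h2⟩
    exact ⟨A, h1.symm, (hP A).2 rfl, h2⟩

theorem exists_node_iff (h : Shape k f D m j b j' a) {t : ℤ} (ht : Offs k j b j' a t) :
    (∃ i ≤ reach k j b + 1, pt m D t = Arc.node ⟨m, D, reach k j b + 1⟩ i) ↔ 0 ≤ t := by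
  have hw := h.width
  have hk := h.one_le
  have hjk := h.le
  have h1 := ht.le_reach
  have h2 := ht.neg_reach_le
  constructor
  · rintro ⟨i, hi, he⟩
    rw [node_eq_pt] at he
    have := pt_injOn he (by omega) (by omega)
    omega
  · intro h0
    refine ⟨t.toNat, by omega, ?_⟩
    rw [node_eq_pt]
    congr 1; omega

theorem hasMissing_iff : Arc.HasMissing ⟨m, D, reach k j b + 1⟩ missing ↔
    ∃ t : ℤ, 0 ≤ t ∧ t ≤ reach k j b ∧ missing = some (edgeAt (pt m D t) D) := by
  constructor
  · rintro ⟨e, he, i, hi, rfl⟩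
    rw [node_eq_pt] at he
    simp only at hi
    exact ⟨i, by omega, by omega, he⟩
  · rintro ⟨t, h1, h2, h3⟩
    refine ⟨_, h3, t.toNat, by simp only; omega, ?_⟩
    rw [node_eq_pt]
    congr 2; omega

theorem not_hasMissing_both (h : Shape k f D m j b j' a) :
    ¬ (Arc.HasMissing ⟨m, D, reach k j b + 1⟩ missing ∧
      Arc.HasMissing ⟨m, D.opp, reach k j' a + 1⟩ missing) := by
  rw [hasMissing_iff, hasMissing_iff]
  rintro ⟨⟨s, hs1, hs2, hs3⟩, t, ht1, ht2, ht3⟩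
  refine h.edgeAt_ne (s := s) (t := t) hs2 ht2 (by omega) ?_
  rw [hs3] at ht3; exact Option.some.inj ht3

variable (h : Shape k f D m j b k a) (hs : ∀ v, f v = .multi ∨ IsHead k f v ↔ v = m)
  (hb : 1 ≤ b) (hj : j < k)

include h hs hb hj

open Classical in
-- The two blocks share no edge, so the case distinction reduces to whether the chain block contains
-- the missing edge. Depending on this, either everything strictly ahead of the head moves forward
-- or the head and everything behind it move backward.
theorem reconstructChain_eq {t : ℤ} (ht : Offs k j b k a t) :
    reconstructChain k f missing (pt m D t) =
      if Arc.HasMissing ⟨m, D.opp, reach k k a + 1⟩ missing then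
        if 0 < t then some D else none
      else if t ≤ 0 then some D.opp else none := by
  have hw := h.width
  have h1 := ht.le_reach
  have h2 := ht.neg_reach_le
  have hC := h.isChainBlock_iff hs hb hj
  have hN := h.isNonChainBlock_iff hs hb hj
  have hhead : (∃ A : Arc n, IsBlock k f A ∧ A.start = pt m D t) ↔ t = 0 := by
    constructor
    · rintro ⟨A, hA, hAt⟩
      have h3 : A.start = pt m D 0 := by
        rw [pt_zero]
        rcases (h.isBlock_iff_or hs hb hj A).1 hA with rfl | rfl <;> rfl
      rw [h3] at hAt
      exact (pt_injOn hAt (by omega) (by omega)).symm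
    · rintro rfl
      exact ⟨_, (h.isBlock_iff_or hs hb hj _).2 (Or.inl rfl), by simp⟩
  have hinC : (∃ A : Arc n, IsChainBlock k f A ∧ A.HasMissing missing) ↔
      Arc.HasMissing ⟨m, D.opp, reach k k a + 1⟩ missing := by simp [hC]
  have hinN : (∃ A : Arc n, IsNonChainBlock k f A ∧ A.HasMissing missing) ↔
      Arc.HasMissing ⟨m, D, reach k j b + 1⟩ missing := by simp [hN]
  have hboth := h.not_hasMissing_both (missing := missing)
  have hcond : (¬ Arc.HasMissing ⟨m, D.opp, reach k k a + 1⟩ missing ∧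
      ¬ Arc.HasMissing ⟨m, D, reach k j b + 1⟩ missing ∨
      Arc.HasMissing ⟨m, D, reach k j b + 1⟩ missing) ↔
      ¬ Arc.HasMissing ⟨m, D.opp, reach k k a + 1⟩ missing := by tauto
  have e1 : theDir (fun E => ∃ A : Arc n, A.dir = E ∧ IsChainBlock k f A ∧ A.start = pt m D t) =
      if pt m D t = m then some D.opp else none := by
    apply theDir_eq
    intro E
    rw [exists_block_iff hC]
    simp only [eq_comm]
  have e2 : theDir (fun E => ∃ A : Arc n, A.dir = E ∧ IsChainBlock k f A ∧
      ∃ i ≤ A.len, pt m D t = A.node i) = if t ≤ 0 then some D.opp else none := by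
    apply theDir_eq
    intro E
    rw [exists_block_iff hC]
    have := h.symm.exists_node_iff ht.symm
    rw [pt_opp, neg_neg] at this
    simp only [this]
    simp
  have e3 : theDir (fun E => ∃ A : Arc n, A.dir = E ∧ IsNonChainBlock k f A ∧
      ∃ i ≤ A.len, pt m D t = A.node i) = if 0 ≤ t then some D else none := by
    apply theDir_eq
    intro E
    rw [exists_block_iff hN]
    have := h.exists_node_iff ht
    simp only [this]
  unfold reconstructChain
  simp only [hhead, hinC, hinN, hcond, e1, e2, e3]
  by_cases h0 : t = 0
  · subst h0
    by_cases hM : Arc.HasMissing ⟨m, D.opp, reach k k a + 1⟩ missing <;> simp [hM]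
  · by_cases hM : Arc.HasMissing ⟨m, D.opp, reach k k a + 1⟩ missing
    · simp [h0, hM, lt_iff_le_and_ne, Ne.symm h0]
    · simp [h0, hM]

omit hs hb hj in
theorem reconstruct_not_blocked {t : ℤ} (ht : Offs k j b k a t)
    (hM : Arc.HasMissing ⟨m, D.opp, reach k k a + 1⟩ missing) (h0 : 0 < t) :
    missing ≠ some (edgeAt (pt m D t) D) := by
  intro he
  exact h.not_hasMissing_both ⟨hasMissing_iff.2 ⟨t, h0.le, ht.le_reach, he⟩, hM⟩

omit hs hb hj h in
theorem reconstruct_not_blocked_opp {t : ℤ} (ht : Offs k j b k a t)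
    (hM : ¬ Arc.HasMissing ⟨m, D.opp, reach k k a + 1⟩ missing) (h0 : t ≤ 0) :
    missing ≠ some (edgeAt (pt m D t) D.opp) := by
  intro he
  refine hM (hasMissing_iff.2 ⟨-t, by omega, ht.symm.le_reach, ?_⟩)
  rw [pt_opp, neg_neg, he]

end Shape

/-! ### Robots in integer coordinates -/

section ConfigOf

variable {n l : ℕ} {pos : Fin l → ZMod n} {v : ZMod n}

theorem occ_configOf : Occ (configOf pos) v ↔ ∃ r, pos r = v := by
  have h : (Finset.univ.filter fun r => pos r = v).card = 0 ↔ ¬ ∃ r, pos r = v := by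
    rw [Finset.card_eq_zero, Finset.filter_eq_empty_iff]; simp
  unfold Occ configOf
  split <;> simp_all

theorem configOf_eq_multi : configOf pos v = .multi ↔ ∃ r s, r ≠ s ∧ pos r = v ∧ pos s = v := by
  have h : 1 < (Finset.univ.filter fun r => pos r = v).card ↔
      ∃ r s, r ≠ s ∧ pos r = v ∧ pos s = v := by
    rw [Finset.one_lt_card]
    simp only [Finset.mem_filter_univ]
    constructor
    · rintro ⟨r, hr, s, hs, hrs⟩; exact ⟨r, s, hrs, hr, hs⟩
    · rintro ⟨r, s, hrs, hr, hs⟩; exact ⟨r, hr, s, hs, hrs⟩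
  rw [← h]
  unfold configOf
  split <;> simp_all

end ConfigOf

/-- The robots are at offsets `x` from `m` in direction `D`: `c` robots are at `m`, `b` robots
follow in direction `D`, the first one at distance `j`, and `a` robots in the other direction, all
further gaps being `k`. -/
structure Placed {n l : ℕ} (k : ℕ) (pos : Fin l → ZMod n) (D : Dir) (m : ZMod n) (x : Fin l → ℤ)
    (c j b a : ℕ) : Prop where
  pos_eq : ∀ r, pos r = pt m D (x r)
  range : ∀ t, (∃ r, x r = t) ↔ Offs k j b k a t
  inj : ∀ r s, x r = x s → r = s ∨ x r = 0
  card : (Finset.univ.filter fun r => x r = 0).card = c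
  one_le : 1 ≤ j
  le : j ≤ k
  pos_of_lt : j < k → 1 ≤ b
  one_le_c : 1 ≤ c
  total : c + a + b = l

/-! ### Ring geometry of a placement and the location of the block head -/

namespace Placed

variable {n l k c j b a : ℕ} {pos : Fin l → ZMod n} {D : Dir} {m : ZMod n} {x : Fin l → ℤ}

theorem reach_add (h : Placed k pos D m x c j b a) : reach k j b + (k - j) = b * k := by
  have h1 := h.le
  -- This settles `b = 0`: without a robot ahead there is no short gap, so `j = k`.
  have h2 := h.pos_of_lt
  cases b with
  | zero => simp only [reach]; omega
  | succ b => simp only [reach, add_mul]; omega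

theorem reach_self (k a : ℕ) : reach k k a = a * k := by
  cases a with
  | zero => simp [reach]
  | succ a => simp only [reach]; ring

theorem span_add (h : Placed k pos D m x c j b a) :
    reach k j b + reach k k a + (k - j) + c * k = l * k := by
  have h1 := h.reach_add
  rw [reach_self, ← h.total]
  linarith

theorem offs (h : Placed k pos D m x c j b a) (r : Fin l) : Offs k j b k a (x r) :=
  (h.range _).1 ⟨r, rfl⟩

theorem width_le (h : Placed k pos D m x c j b a) (hn : l * k ≤ n) :
    reach k j b + reach k k a + k ≤ n := by
  have h1 := h.span_add
  have h2 := Nat.mul_le_mul_right k h.one_le_c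
  omega

/-- Strictness comes from a robot not yet detached or from an unfinished gap. In the final
configuration the closing gap may be exactly `k`, so `Shape` is not available there. -/
theorem width_lt (h : Placed k pos D m x c j b a) (hn : l * k ≤ n) (hc : 2 ≤ c ∨ j < k) :
    reach k j b + reach k k a + k < n := by
  have h1 := h.span_add
  have h2 := Nat.mul_le_mul_right k h.one_le_c
  have h3 := h.one_le
  have h4 := h.le
  rcases hc with hc | hc
  · have h5 := Nat.mul_le_mul_right k hc
    omega
  · omega

theorem shape (h : Placed k pos D m x c j b a) (hn : l * k ≤ n) (hc : 2 ≤ c ∨ j < k) :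
    Shape k (configOf pos) D m j b k a where
  occ v := by
    rw [occ_configOf]
    constructor
    · rintro ⟨r, rfl⟩
      exact ⟨x r, h.offs r, h.pos_eq r⟩
    · rintro ⟨t, ht, rfl⟩
      obtain ⟨r, rfl⟩ := (h.range t).2 ht
      exact ⟨r, h.pos_eq r⟩
  width := h.width_lt hn hc
  one_le := h.one_le
  le := h.le
  one_le' := h.one_le.trans h.le
  le' := le_refl _
  full := Or.inr rfl

theorem pos_inj (h : Placed k pos D m x c j b a) (hn : l * k ≤ n) {r s : Fin l}
    (hrs : pos r = pos s) : x r = x s := by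
  rw [h.pos_eq, h.pos_eq] at hrs
  have h1 := h.width_le hn
  have := (h.offs r).le_reach
  have := (h.offs r).neg_reach_le
  have := (h.offs s).le_reach
  have := (h.offs s).neg_reach_le
  have := h.one_le
  have := h.le
  exact pt_injOn hrs (by omega) (by omega)

theorem multi_iff (h : Placed k pos D m x c j b a) (hn : l * k ≤ n) (v : ZMod n) :
    configOf pos v = .multi ↔ v = m ∧ 2 ≤ c := by
  have hcard : 2 ≤ c ↔ ∃ r s, r ≠ s ∧ x r = 0 ∧ x s = 0 := by
    rw [← h.card, Nat.succ_le_iff, Finset.one_lt_card]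
    simp only [Finset.mem_filter_univ]
    constructor
    · rintro ⟨r, hr, s, hs, hrs⟩; exact ⟨r, s, hrs, hr, hs⟩
    · rintro ⟨r, s, hrs, hr, hs⟩; exact ⟨r, hr, s, hs, hrs⟩
  rw [configOf_eq_multi, hcard]
  constructor
  · rintro ⟨r, s, hrs, rfl, hs⟩
    have h1 := h.pos_inj hn hs
    have h2 := (h.inj s r h1).resolve_left hrs.symm
    exact ⟨by rw [h.pos_eq, ← h1, h2, pt_zero], r, s, hrs, by omega, h2⟩
  · rintro ⟨rfl, r, s, hrs, hr, hs⟩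
    exact ⟨r, s, hrs, by rw [h.pos_eq, hr, pt_zero], by rw [h.pos_eq, hs, pt_zero]⟩

theorem symm (h : Placed k pos D m x c k b a) : Placed k pos D.opp m (fun r => -x r) c k a b where
  pos_eq r := by rw [h.pos_eq, pt_opp, neg_neg]
  range t := by
    constructor
    · rintro ⟨r, rfl⟩; exact (h.offs r).symm
    · intro ht
      obtain ⟨r, hr⟩ := (h.range _).2 ht.symm
      exact ⟨r, by omega⟩
  inj r s hrs := by
    rcases h.inj r s (by omega) with h1 | h1
    · exact Or.inl h1
    · right; omega
  card := by simpa using h.card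
  one_le := h.one_le
  le := h.le
  pos_of_lt := by omega
  one_le_c := h.one_le_c
  total := by have := h.total; omega

/-- If no node is a multiplicity node, the other end of the short gap serves as the origin. -/
theorem rebase (h : Placed k pos D m x 1 j (b + 1) a) :
    Placed k pos D.opp (pt m D j) (fun r => j - x r) 1 j (a + 1) b := by
  have hk := h.one_le
  have hinj (r s : Fin l) (hrs : x r = x s) : r = s := by
    rcases h.inj r s hrs with h1 | h1
    · exact h1
    · have := Finset.card_le_one.1 h.card.le r (by simpa using h1) s (by simp; omega)
      exact this
  -- The reflection `t ↦ j - t` exchanges the ends of the short gap; the old origin joins the side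
  -- of the `a` robots, and the first robot ahead becomes the origin, which shifts the indices by
  -- one.
  have hoff (t : ℤ) : Offs k j (b + 1) k a t ↔ Offs k j (a + 1) k b (j - t) := by
    constructor
    · rintro ((rfl | ⟨i, hi, rfl⟩) | (h0 | ⟨i, hi, h0⟩))
      · exact Or.inl (Or.inr ⟨0, by omega, by simp⟩)
      · cases i with
        | zero => left; left; simp
        | succ i => right; right; exact ⟨i, by omega, by push_cast; ring⟩
      · exact Or.inl (Or.inr ⟨0, by omega, by simp; omega⟩)
      · left; right
        exact ⟨i + 1, by omega, by push_cast; linarith⟩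
    · rintro ((h0 | ⟨i, hi, h0⟩) | (h0 | ⟨i, hi, h0⟩))
      · exact Or.inl (Or.inr ⟨0, by omega, by simp; omega⟩)
      · cases i with
        | zero => left; left; simp at h0; omega
        | succ i => right; right; exact ⟨i, by omega, by push_cast at h0; linarith⟩
      · exact Or.inl (Or.inr ⟨0, by omega, by simp; omega⟩)
      · left; right
        exact ⟨i + 1, by omega, by push_cast; linarith⟩
  refine ⟨fun r => ?_, fun t => ?_, fun r s hrs => ?_, ?_, h.one_le, h.le, by omega, le_refl _, ?_⟩
  · rw [h.pos_eq, pt_opp, pt_pt]; congr 1; ring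
  · rw [show t = j - (j - t) by ring, ← hoff, ← h.range]
    constructor
    · rintro ⟨r, hr⟩; exact ⟨r, by omega⟩
    · rintro ⟨r, hr⟩; exact ⟨r, by omega⟩
  · exact Or.inl (hinj r s (by omega))
  · obtain ⟨r, hr⟩ := (h.range j).2 (Or.inl (Or.inr ⟨0, by omega, by simp⟩))
    rw [Finset.card_eq_one]
    refine ⟨r, ?_⟩
    ext s
    simp only [Finset.mem_filter_univ, Finset.mem_singleton]
    constructor
    · intro hs; exact hinj s r (by omega)
    · rintro rfl; omega
  · have := h.total; omega

theorem isHead_iff (h : Placed k pos .cw m x 1 j b a) (hn : l * k ≤ n) (hj : j < k) (v : ZMod n) :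
    IsHead k (configOf pos) v ↔ v = m := by
  have hS := h.shape hn (Or.inr hj)
  have hw := hS.width
  have : NeZero n := ⟨by omega⟩
  have hj1 := h.one_le
  have hb := h.pos_of_lt hj
  have hoj : Offs k j b k a j := Or.inl (Or.inr ⟨0, hb, by simp⟩)
  have hjr := hoj.le_reach
  have hpair (x' y' : ZMod n) : (Occ (configOf pos) x' ∧ Occ (configOf pos) y' ∧ x' ≠ y' ∧
      dirDist .cw x' y' < k) ↔ x' = m ∧ y' = pt m .cw j := by
    constructor
    · rintro ⟨h1, h2, h3, h4⟩
      obtain ⟨s, hs, rfl⟩ := (hS.occ _).1 h1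
      obtain ⟨t, ht, rfl⟩ := (hS.occ _).1 h2
      have hs1 := hs.le_reach
      have hs2 := hs.neg_reach_le
      have ht1 := ht.le_reach
      have ht2 := ht.neg_reach_le
      rcases lt_trichotomy s t with hst | rfl | hst
      · have h5 := dirDist_pt_of_le (m := m) (D := .cw) hst.le (by omega)
        rcases hs.gap h.one_le hS.one_le' hS.full ht hst with h6 | ⟨rfl, rfl⟩ | h6
        · omega
        · simp
        · omega
      · exact absurd rfl h3
      · have h5 := dirDist_pt_of_lt (m := m) (D := .cw) hst (by omega)
        omega
    · rintro ⟨rfl, rfl⟩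
      refine ⟨hS.center_occ, hS.occ_of_offs hoj, ?_, ?_⟩
      · intro he
        have := pt_injOn (m := x') (D := .cw) (s := 0) (t := j) (by simpa using he) (by omega)
          (by omega)
        omega
      · have h5 := dirDist_pt_of_le (m := x') (D := .cw) (s := 0) (t := j) (by omega) (by omega)
        rw [pt_zero] at h5
        omega
  constructor
  · rintro ⟨-, y, h1, -⟩
    exact ((hpair _ _).1 h1).1
  · rintro rfl
    refine ⟨fun w hw => ?_, _, (hpair _ _).2 ⟨rfl, rfl⟩, fun x' y' h1 h2 h3 h4 => ?_⟩
    · have := ((h.multi_iff hn w).1 hw).2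
      omega
    · exact (hpair _ _).1 ⟨h1, h2, h3, h4⟩

theorem start_iff (h : Placed k pos D m x c j b a) (hn : l * k ≤ n) (hj : j < k)
    (hD : 2 ≤ c ∨ D = .cw) (v : ZMod n) :
    configOf pos v = .multi ∨ IsHead k (configOf pos) v ↔ v = m := by
  rw [h.multi_iff hn]
  by_cases hc : 2 ≤ c
  · have : ¬ IsHead k (configOf pos) v := fun hh =>
      hh.1 m ((h.multi_iff hn m).2 ⟨rfl, hc⟩)
    simp [hc, this]
  · obtain rfl : c = 1 := by have := h.one_le_c; omega
    obtain rfl := hD.resolve_left hc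
    simp [h.isHead_iff hn hj]

/-- Whenever there is a short gap, the origin can be taken to be the block head. -/
theorem exists_head (h : Placed k pos D m x c j b a) (hj : j < k) :
    ∃ D' m' x' b' a', Placed k pos D' m' x' c j b' a' ∧ (2 ≤ c ∨ D' = .cw) := by
  by_cases hc : 2 ≤ c
  · exact ⟨_, _, _, _, _, h, Or.inl hc⟩
  · obtain rfl : c = 1 := by have := h.one_le_c; omega
    cases D with
    | cw => exact ⟨_, _, _, _, _, h, Or.inr rfl⟩
    | ccw =>
      -- Heads are defined by clockwise distance, so here the head is the other end of the short
      -- gap.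
      obtain ⟨b, rfl⟩ := Nat.exists_eq_add_of_le' (h.pos_of_lt hj)
      exact ⟨_, _, _, _, _, h.rebase, Or.inr rfl⟩

end Placed

namespace Placed

variable {n l k c j b a : ℕ} {pos pos' : Fin l → ZMod n} {D : Dir} {m m' : ZMod n}
  {x : Fin l → ℤ}

/-! ### Effect of one round on the coordinates -/

/-- The new origin `m'` is arbitrary because the front group moving forward and the rear group
moving backward give the same relative coordinates. -/
theorem widen (h : Placed k pos D m x c j b a) (hj : j < k)
    (hpos : ∀ r, pos' r = pt m' D (if 0 < x r then x r + 1 else x r)) :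
    Placed k pos' D m' (fun r => if 0 < x r then x r + 1 else x r) c (j + 1) b a where
  pos_eq := hpos
  range t := by
    have hoff : Offs k (j + 1) b k a t ↔
        (0 < t ∧ Offs k j b k a (t - 1) ∧ 0 < t - 1) ∨ (t ≤ 0 ∧ Offs k j b k a t) := by
      have := h.one_le
      constructor
      · rintro ((rfl | ⟨i, hi, rfl⟩) | h0)
        · exact Or.inr ⟨le_refl _, offs_zero⟩
        · have : (0 : ℤ) ≤ i * k := by positivity
          exact Or.inl ⟨by omega, Or.inl (Or.inr ⟨i, hi, by push_cast; ring⟩), by omega⟩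
        · exact Or.inr ⟨by have := h0.nonneg; omega, Or.inr h0⟩
      · rintro (⟨h1, h2 | h2, h3⟩ | ⟨h1, h2 | h2⟩)
        · rcases h2 with h2 | ⟨i, hi, h2⟩
          · omega
          · exact Or.inl (Or.inr ⟨i, hi, by push_cast; linarith⟩)
        · have := h2.nonneg; omega
        · have := h2.nonneg
          exact Or.inl (Or.inl (by omega))
        · exact Or.inr h2
    rw [hoff, ← h.range, ← h.range]
    constructor
    · rintro ⟨r, rfl⟩
      split_ifs with h0
      · exact Or.inl ⟨by omega, ⟨r, by omega⟩, by omega⟩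
      · exact Or.inr ⟨by omega, r, rfl⟩
    · rintro (⟨h1, ⟨r, hr⟩, h2⟩ | ⟨h1, r, hr⟩)
      · exact ⟨r, by rw [if_pos (by omega)]; omega⟩
      · exact ⟨r, by rw [if_neg (by omega)]; omega⟩
  inj r s hrs := by
    have := h.inj r s
    split_ifs at hrs ⊢ <;> omega
  card := by
    rw [← h.card]
    congr 1
    ext r
    simp only [Finset.mem_filter_univ]
    split_ifs <;> omega
  one_le := by omega
  le := by omega
  pos_of_lt _ := h.pos_of_lt hj
  one_le_c := h.one_le_c
  total := h.total

/-- The detached robot `r₀` and the side ahead of it shift together, so `r₀` becomes the first robot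
ahead, at distance `1`, and is still `k` behind the next one, if any. -/
theorem split (h : Placed k pos D m x (c + 1) k b a) (hc : 1 ≤ c) {r₀ : Fin l} (h0 : x r₀ = 0)
    (hpos : ∀ r, pos' r = pt m D (if 0 < x r ∨ r = r₀ then x r + 1 else x r)) :
    Placed k pos' D m (fun r => if 0 < x r ∨ r = r₀ then x r + 1 else x r) c 1 (b + 1) a where
  pos_eq := hpos
  range t := by
    have hk := h.one_le
    have hoff : Offs k 1 (b + 1) k a t ↔
        t = 1 ∨ (0 < t ∧ Offs k k b k a (t - 1) ∧ 0 < t - 1) ∨ (t ≤ 0 ∧ Offs k k b k a t) := by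
      constructor
      · rintro ((rfl | ⟨i, hi, rfl⟩) | h1)
        · exact Or.inr (Or.inr ⟨le_refl _, offs_zero⟩)
        · cases i with
          | zero => left; simp
          | succ i =>
            have : (0 : ℤ) ≤ i * k := by positivity
            refine Or.inr (Or.inl ⟨by positivity, Or.inl (Or.inr ⟨i, by omega, ?_⟩), ?_⟩)
            · push_cast; ring
            · push_cast; linarith
        · exact Or.inr (Or.inr ⟨by have := h1.nonneg; omega, Or.inr h1⟩)
      · rintro (rfl | ⟨h1, h2 | h2, h3⟩ | ⟨h1, h2 | h2⟩)
        · exact Or.inl (Or.inr ⟨0, by omega, by simp⟩)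
        · rcases h2 with h2 | ⟨i, hi, h2⟩
          · omega
          · exact Or.inl (Or.inr ⟨i + 1, by omega, by push_cast; linarith⟩)
        · have := h2.nonneg; omega
        · have := h2.nonneg
          exact Or.inl (Or.inl (by omega))
        · exact Or.inr h2
    rw [hoff, ← h.range, ← h.range]
    constructor
    · rintro ⟨r, rfl⟩
      split_ifs with h1
      · rcases h1 with h1 | rfl
        · exact Or.inr (Or.inl ⟨by omega, ⟨r, by omega⟩, by omega⟩)
        · left; omega
      · exact Or.inr (Or.inr ⟨by omega, r, rfl⟩)
    · rintro (rfl | ⟨h1, ⟨r, hr⟩, h2⟩ | ⟨h1, r, hr⟩)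
      · exact ⟨r₀, by simp [h0]⟩
      · exact ⟨r, by rw [if_pos (by omega)]; omega⟩
      · rcases eq_or_ne t 0 with rfl | ht
        · have h3 : 1 < (Finset.univ.filter fun r => x r = 0).card := by rw [h.card]; omega
          obtain ⟨s, hs, hsr⟩ := Finset.exists_mem_ne h3 r₀
          rw [Finset.mem_filter_univ] at hs
          exact ⟨s, by simp [hs, hsr]⟩
        · refine ⟨r, ?_⟩
          rw [if_neg, hr]
          rintro (h3 | rfl) <;> omega
  inj r s hrs := by
    have h1 := h.inj r s
    have h2 := h.inj r₀ s
    by_cases hr : r = r₀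
    · subst hr
      by_cases hs : s = r
      · exact Or.inl hs.symm
      · split_ifs at hrs ⊢ <;> omega
    · by_cases hs : s = r₀
      · subst hs
        split_ifs at hrs ⊢ <;> omega
      · split_ifs at hrs ⊢ <;> omega
  card := by
    have h1 : (Finset.univ.filter fun r => (if 0 < x r ∨ r = r₀ then x r + 1 else x r) = 0) =
        (Finset.univ.filter fun r => x r = 0).erase r₀ := by
      ext r
      simp only [Finset.mem_filter_univ, Finset.mem_erase]
      by_cases hr : r = r₀
      · subst hr; simp [h0]
      · split_ifs <;> omega
    rw [h1, Finset.card_erase_of_mem (by simpa using h0), h.card]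
    omega
  one_le := le_refl _
  le := h.one_le
  pos_of_lt _ := by omega
  one_le_c := hc
  total := by have := h.total; omega

end Placed

/-! ### Rounds of the two subroutines in coordinates, and the final configuration -/

section Rounds

variable {n l k c j b a : ℕ} {pos : Fin l → ZMod n} {D : Dir} {m : ZMod n} {x : Fin l → ℤ}
  {Λ : Type*} [LinearOrder Λ] {label : Fin l → Λ} {missing : Option (ZMod n)}

theorem round_of_none {r : Fin l} (h : action k label missing pos r = none) :
    round k label missing pos r = pos r := by
  simp [round, h]

theorem round_of_some {r : Fin l} (h : action k label missing pos r = some D)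
    (he : missing ≠ some (edgeAt (pos r) D)) :
    round k label missing pos r = pos r + D.unit := by
  simp [round, h, he]

theorem Placed.round_reconstruct (h : Placed k pos D m x c j b a) (hn : l * k ≤ n) (hj : j < k)
    (hD : 2 ≤ c ∨ D = .cw) :
    ∃ m', Placed k (round k label missing pos) D m' (fun r => if 0 < x r then x r + 1 else x r)
      c (j + 1) b a := by
  have hS := h.shape hn (Or.inr hj)
  have hb := h.pos_of_lt hj
  have hs := h.start_iff hn hj hD
  have hnc : ¬ IsChainConfig k (configOf pos) :=
    hS.not_isChainConfig hb hj fun v hv => (hs v).1 (Or.inl hv)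
  have hact (r : Fin l) : action k label missing pos r =
      reconstructChain k (configOf pos) missing (pt m D (x r)) := by
    rw [action, dynamicRing, if_neg hnc, h.pos_eq]
  by_cases hM : Arc.HasMissing ⟨m, D.opp, reach k k a + 1⟩ missing
  · refine ⟨m, h.widen hj fun r => ?_⟩
    have h1 := hact r
    rw [hS.reconstructChain_eq hs hb hj (h.offs r), if_pos hM] at h1
    split_ifs at h1 ⊢ with h0
    · rw [round_of_some h1, h.pos_eq, pt_add_unit]
      rw [h.pos_eq]
      exact hS.reconstruct_not_blocked (h.offs r) hM h0
    · rw [round_of_none h1, h.pos_eq]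
  -- The head retreats with the rear group, so the origin moves with it and the robots ahead gain
  -- one unit of offset by standing still.
  · refine ⟨pt m D (-1), h.widen hj fun r => ?_⟩
    have h1 := hact r
    rw [hS.reconstructChain_eq hs hb hj (h.offs r), if_neg hM] at h1
    rw [pt_pt]
    by_cases h0 : 0 < x r
    · rw [if_neg (by omega)] at h1
      rw [if_pos h0, round_of_none h1, h.pos_eq]
      congr 1; ring
    · rw [if_pos (by omega)] at h1
      rw [if_neg h0, round_of_some h1, h.pos_eq, Dir.unit_opp]
      · simp only [pt]; push_cast; ring
      · rw [h.pos_eq]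
        exact Shape.reconstruct_not_blocked_opp (h.offs r) hM (by omega)

theorem Placed.round_spread_of_dir (hlabel : Function.Injective label)
    (h : Placed k pos D m x (c + 1) k b a) (hn : l * k ≤ n) (hc : 1 ≤ c)
    (hD : spreadDir k (configOf pos) missing = D) :
    ∃ x', Placed k (round k label missing pos) D m x' c 1 (b + 1) a := by
  classical
  have hS := h.shape hn (Or.inl (by omega))
  have hm (v : ZMod n) : configOf pos v = .multi ↔ v = m := by
    rw [h.multi_iff hn]; simp; omega
  have hcc := hS.isChainConfig hm
  obtain ⟨r₀, hr₀, hmin⟩ := Finset.exists_min_image (Finset.univ.filter fun r => x r = 0) label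
    (Finset.card_pos.1 (by rw [h.card]; omega))
  rw [Finset.mem_filter_univ] at hr₀
  have hleast (r : Fin l) (hr : x r = 0) :
      (∀ r', pos r' = pos r → label r ≤ label r') ↔ r = r₀ := by
    constructor
    · intro hl
      refine hlabel (le_antisymm (hl r₀ ?_) (hmin r (by simpa using hr)))
      rw [h.pos_eq, h.pos_eq, hr, hr₀]
    · rintro rfl r' hr'
      exact hmin r' (by simpa using (h.pos_inj hn hr').trans hr)
  have hact (r : Fin l) : action k label missing pos r =
      if 0 < x r ∨ r = r₀ then some D else none := by
    rw [action, dynamicRing, if_pos hcc, h.pos_eq, hS.spread_eq hm hD (h.offs r)]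
    congr 1
    rw [← h.pos_eq]
    by_cases hr : x r = 0
    · simp only [hleast r hr, hr, true_and]
    · have : r ≠ r₀ := by rintro rfl; exact hr hr₀
      simp [hr, this]
  refine ⟨_, h.split hc hr₀ fun r => ?_⟩
  have h1 := hact r
  split_ifs at h1 ⊢ with h0
  · rw [round_of_some h1, h.pos_eq, pt_add_unit]
    rw [h.pos_eq]
    refine hS.spread_not_blocked hm hD ?_ (h.offs r).le_reach
    rcases h0 with h0 | rfl <;> omega
  · rw [round_of_none h1, h.pos_eq]

/-- With all gaps equal to `k` the placement can be reflected, so the direction chosen by `Spread`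
may be taken as the reference direction. -/
theorem Placed.round_spread (hlabel : Function.Injective label)
    (h : Placed k pos D m x (c + 1) k b a) (hn : l * k ≤ n) (hc : 1 ≤ c) :
    ∃ D' x' b' a', Placed k (round k label missing pos) D' m x' c 1 (b' + 1) a' ∧
      a' + b' = a + b := by
  rcases D.eq_or_eq_opp (spreadDir k (configOf pos) missing) with hD | hD
  · obtain ⟨x', hx'⟩ := h.round_spread_of_dir hlabel hn hc hD
    exact ⟨_, _, _, _, hx', rfl⟩
  · obtain ⟨x', hx'⟩ := h.symm.round_spread_of_dir hlabel hn hc hD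
    exact ⟨_, _, _, _, hx', by omega⟩

/-! ### The target configuration -/

/-- On the occupied arc all gaps are `k`; a path across the closing gap has length at least `k` by
`width_le`. -/
theorem Placed.le_dirDist (h : Placed k pos D m x 1 k b a) (hn : l * k ≤ n) (E : Dir)
    {v w : ZMod n} (hv : Occ (configOf pos) v) (hw : Occ (configOf pos) w) (hvw : v ≠ w) :
    k ≤ dirDist E v w := by
  wlog hE : E = D generalizing D x a b
  · exact this h.symm ((D.eq_or_eq_opp E).resolve_left hE)
  subst hE
  obtain ⟨r, rfl⟩ := occ_configOf.1 hv
  obtain ⟨s, rfl⟩ := occ_configOf.1 hw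
  have hk := h.one_le
  have h1 := h.width_le hn
  have : NeZero n := ⟨by omega⟩
  have := (h.offs r).le_reach
  have := (h.offs r).neg_reach_le
  have := (h.offs s).le_reach
  have := (h.offs s).neg_reach_le
  rw [h.pos_eq, h.pos_eq] at hvw ⊢
  rcases lt_trichotomy (x r) (x s) with hrs | hrs | hrs
  · have h2 := dirDist_pt_of_le (m := m) (D := E) hrs.le (by omega)
    rcases (h.offs r).gap hk hk (Or.inl rfl) (h.offs s) hrs <;> omega
  · rw [hrs] at hvw; exact absurd rfl hvw
  · have h2 := dirDist_pt_of_lt (m := m) (D := E) hrs (by omega)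
    omega

theorem Placed.dispersed (h : Placed k pos D m x 1 j b a) (hn : l * k ≤ n) :
    Dispersed (configOf pos) := by
  intro v hv
  have := ((h.multi_iff hn v).1 hv).2
  omega

theorem Placed.isTarget (h : Placed k pos D m x 1 k b a) (hn : l * k ≤ n) :
    IsTarget k (configOf pos) :=
  ⟨h.dispersed hn, fun E _ _ hc => h.le_dirDist hn E hc.1 hc.2.1 hc.2.2.1⟩

theorem Placed.solvesDkD (h : Placed k pos D m x 1 k b a) (hn : l * k ≤ n) (hl : 2 ≤ l) :
    SolvesDkD k (configOf pos) := by
  have hk := h.one_le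
  refine ⟨fun v hv => ?_, fun v w hv hw hvw => ?_, ?_⟩
  · have := h.dispersed hn v
    unfold Occ at hv
    cases hf : configOf pos v <;> simp_all
  · exact le_min (h.le_dirDist hn _ hv hw hvw) (h.le_dirDist hn _ hv hw hvw)
  · wlog hb : 1 ≤ b generalizing D x a b
    · exact this h.symm (by have := h.total; omega)
    have h2 : 2 * k ≤ n := (Nat.mul_le_mul_right k hl).trans hn
    have : NeZero n := ⟨by omega⟩
    obtain ⟨r, hr⟩ := (h.range 0).2 offs_zero
    obtain ⟨s, hs⟩ := (h.range k).2 (Or.inl (Or.inr ⟨0, hb, by simp⟩))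
    have hv : Occ (configOf pos) (pos r) := occ_configOf.2 ⟨r, rfl⟩
    have hw : Occ (configOf pos) (pos s) := occ_configOf.2 ⟨s, rfl⟩
    have hvw : pos r ≠ pos s := fun he => by
      have := h.pos_inj hn he
      omega
    refine ⟨_, _, hv, hw, hvw, ?_⟩
    refine le_antisymm ?_ (le_min (h.le_dirDist hn _ hv hw hvw) (h.le_dirDist hn _ hv hw hvw))
    have h3 := dirDist_pt_of_le (m := m) (D := D) (s := x r) (t := x s) (by omega) (by omega)
    rw [← h.pos_eq, ← h.pos_eq] at h3
    have h4 : ringDist (pos r) (pos s) ≤ dirDist D (pos r) (pos s) := by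
      cases D
      · exact min_le_left _ _
      · exact min_le_right _ _
    omega

/-- Without a multiplicity node there is no chain, and without a pair closer than `k` there is no
head, hence no block. -/
theorem Placed.action_eq_none (h : Placed k pos D m x 1 k b a) (hn : l * k ≤ n) (r : Fin l) :
    action k label missing pos r = none := by
  have hd := h.dispersed hn
  have hnc : ¬ IsChainConfig k (configOf pos) := fun hc => by
    obtain ⟨A, -, hA⟩ := hc .cw
    exact hd _ hA.2.2.1
  have hnb (A : Arc n) : ¬ IsBlock k (configOf pos) A := by
    rintro ⟨⟨-, -, h1 | ⟨-, y, ⟨h1, h2, h3, h4⟩, -⟩, -⟩, -⟩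
    · exact hd _ h1
    · exact absurd (h.le_dirDist hn .cw h1 h2 h3) (by omega)
  rw [action, dynamicRing, if_neg hnc]
  simp [reconstructChain, IsChainBlock, IsNonChainBlock, hnb, theDir]

end Rounds

/-! ### Executions -/

/-- Coordinates after `t` rounds: every round moves the robots apart by one more edge. -/
def PlacedAt {n l : ℕ} (k : ℕ) (pos : Fin l → ZMod n) (t c j : ℕ) : Prop :=
  ∃ D m x b a, Placed k pos D m x c j b a ∧ t + (k - j) = (a + b) * k

section Exec

variable {n l k : ℕ} {Λ : Type*} [LinearOrder Λ] {label : Fin l → Λ} {root : ZMod n}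
  {missing : ℕ → Option (ZMod n)}

theorem placedAt_zero (hk : 1 ≤ k) (hl : 1 ≤ l) :
    PlacedAt k (exec k label missing root 0) 0 l k := by
  refine ⟨.cw, root, fun _ => 0, 0, 0, ⟨fun r => by simp [exec], fun t => ?_, fun r s _ => Or.inr rfl,
    by simp, hk, le_refl _, by omega, hl, by omega⟩, by simp⟩
  constructor
  · rintro ⟨r, rfl⟩; exact offs_zero
  · rintro ((rfl | ⟨i, hi, -⟩) | (h | ⟨i, hi, -⟩))
    · exact ⟨⟨0, hl⟩, rfl⟩
    · omega
    · exact ⟨⟨0, hl⟩, by omega⟩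
    · omega

theorem PlacedAt.step {pos : Fin l → ZMod n} {t c j : ℕ} {e : Option (ZMod n)}
    (h : PlacedAt k pos t c j) (hlabel : Function.Injective label) (hn : l * k ≤ n)
    (hcj : 2 ≤ c ∨ j < k) : ∃ c' j', PlacedAt k (round k label e pos) (t + 1) c' j' := by
  obtain ⟨D, m, x, b, a, hP, ht⟩ := h
  have hk := hP.one_le
  by_cases hj : j < k
  · obtain ⟨D', m', x', b', a', hP', hD'⟩ := hP.exists_head hj
    obtain ⟨m'', hR⟩ := hP'.round_reconstruct (label := label) (missing := e) hn hj hD'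
    refine ⟨_, _, _, _, _, _, _, hR, ?_⟩
    have : a' + b' = a + b := by have := hP.total; have := hP'.total; omega
    rw [this]; omega
  · obtain rfl : j = k := by have := hP.le; omega
    obtain ⟨c, rfl⟩ := Nat.exists_eq_add_of_le' (show 1 ≤ c by omega)
    obtain ⟨D', x', b', a', hR, hab⟩ := hP.round_spread (missing := e) hlabel hn (by omega)
    refine ⟨_, _, _, _, _, _, _, hR, ?_⟩
    rw [← add_assoc, hab, add_mul]; omega

/-- Together with `1 ≤ j ≤ k`, the equation determines `c` and `j` from the time alone, whatever the
adversary does. -/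
theorem PlacedAt.time {pos : Fin l → ZMod n} {t c j : ℕ} (h : PlacedAt k pos t c j) :
    t + (k - j) + c * k = l * k ∧ 1 ≤ c ∧ 1 ≤ j ∧ j ≤ k := by
  obtain ⟨D, m, x, b, a, hP, ht⟩ := h
  refine ⟨?_, hP.one_le_c, hP.one_le, hP.le⟩
  rw [ht, ← hP.total]; ring

theorem exists_placedAt (hk : 1 ≤ k) (hl : 1 ≤ l) (hlabel : Function.Injective label)
    (hn : l * k ≤ n) (t : ℕ) (ht : t ≤ (l - 1) * k) :
    ∃ c j, PlacedAt k (exec k label missing root t) t c j := by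
  induction t with
  | zero => exact ⟨_, _, placedAt_zero hk hl⟩
  | succ t ih =>
    obtain ⟨c, j, h⟩ := ih (by omega)
    refine h.step hlabel hn ?_
    obtain ⟨h1, h2, h3, h4⟩ := h.time
    by_contra! hcj
    obtain rfl : c = 1 := by omega
    rw [Nat.sub_mul] at ht
    omega

theorem placedAt_final (hk : 1 ≤ k) (hl : 1 ≤ l) (hlabel : Function.Injective label)
    (hn : l * k ≤ n) :
    PlacedAt k (exec k label missing root ((l - 1) * k)) ((l - 1) * k) 1 k := by
  obtain ⟨c, j, h⟩ := exists_placedAt (missing := missing) (root := root) hk hl hlabel hn _ le_rfl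
  obtain ⟨h1, h2, h3, h4⟩ := h.time
  have h5 : (l - 1) * k + k = l * k := by
    obtain ⟨l, rfl⟩ := Nat.exists_eq_add_of_le' hl
    simp [add_mul]
  have h6 := Nat.mul_le_mul_right k h2
  -- At this time the equation reads `(k - j) + c * k = k`, and `c * k` is already at least `k`.
  obtain rfl : j = k := by omega
  obtain rfl : c = 1 := by
    by_contra hc
    have := Nat.mul_le_mul_right j (show 2 ≤ c by omega)
    omega
  exact h

theorem exec_final (hk : 1 ≤ k) (hl : 1 ≤ l) (hlabel : Function.Injective label)
    (hn : l * k ≤ n) {t : ℕ} (ht : (l - 1) * k ≤ t) :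
    exec k label missing root t = exec k label missing root ((l - 1) * k) := by
  induction t, ht using Nat.le_induction with
  | base => rfl
  | succ t ht ih =>
    obtain ⟨D, m, x, b, a, hP, -⟩ := placedAt_final (missing := missing) (root := root)
      hk hl hlabel hn
    funext r
    rw [exec, ih, round_of_none (hP.action_eq_none hn r)]

theorem PlacedAt.isChainConfig_or_isTarget {pos : Fin l → ZMod n} {t c : ℕ}
    (h : PlacedAt k pos t c k) (hn : l * k ≤ n) :
    IsChainConfig k (configOf pos) ∨ IsTarget k (configOf pos) := by
  obtain ⟨D, m, x, b, a, hP, ht⟩ := h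
  by_cases hc : 2 ≤ c
  · left
    exact (hP.shape hn (Or.inl hc)).isChainConfig fun v => by rw [hP.multi_iff hn]; simp [hc]
  · right
    obtain rfl : c = 1 := by have := hP.one_le_c; omega
    exact hP.isTarget hn

theorem PlacedAt.existsUnique_blocks {pos : Fin l → ZMod n} {t c j : ℕ}
    (h : PlacedAt k pos t c j) (hn : l * k ≤ n) (hj : j < k) :
    (∃! A : Arc n, IsChainBlock k (configOf pos) A) ∧
      ∃! A : Arc n, IsNonChainBlock k (configOf pos) A := by
  obtain ⟨D, m, x, b, a, hP, ht⟩ := h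
  obtain ⟨D', m', x', b', a', hP', hD'⟩ := hP.exists_head hj
  have hS := hP'.shape hn (Or.inr hj)
  have hs := hP'.start_iff hn hj hD'
  have hb := hP'.pos_of_lt hj
  have hC := hS.isChainBlock_iff hs hb hj
  have hN := hS.isNonChainBlock_iff hs hb hj
  exact ⟨⟨_, (hC _).2 rfl, fun A hA => (hC A).1 hA⟩, ⟨_, (hN _).2 rfl, fun A hA => (hN A).1 hA⟩⟩

end Exec

end DynRing

theorem mainTheorem4 (n k l : ℕ) (hk : 1 ≤ k) (hl : 2 ≤ l) (hlk : l ≤ n / k)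
    {Λ : Type*} [LinearOrder Λ] (label : Fin l → Λ) (hlabel : Function.Injective label)
    (root : ZMod n) (missing : ℕ → Option (ZMod n)) :
    (∃ T : ℕ, T ≤ (l - 1) * k ∧
      DynRing.IsTarget k (DynRing.configOf (DynRing.exec k label missing root T)) ∧
      DynRing.SolvesDkD k (DynRing.configOf (DynRing.exec k label missing root T)) ∧
      ∀ t, T ≤ t → ∀ r : Fin l,
        DynRing.action k label (missing t) (DynRing.exec k label missing root t) r = none ∧
        DynRing.exec k label missing root t r = DynRing.exec k label missing root T r) ∧
    (l - 1) * k < n ∧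
    (∀ t, ¬ DynRing.IsChainConfig k (DynRing.configOf (DynRing.exec k label missing root t)) →
      ¬ DynRing.IsTarget k (DynRing.configOf (DynRing.exec k label missing root t)) →
      (∃! A : DynRing.Arc n, DynRing.IsChainBlock k
        (DynRing.configOf (DynRing.exec k label missing root t)) A) ∧
      (∃! A : DynRing.Arc n, DynRing.IsNonChainBlock k
        (DynRing.configOf (DynRing.exec k label missing root t)) A) ∧
      ∃ t', t < t' ∧ t' ≤ t + (k - 1) ∧
        (DynRing.IsChainConfig k (DynRing.configOf (DynRing.exec k label missing root t')) ∨
          DynRing.IsTarget k (DynRing.configOf (DynRing.exec k label missing root t')))) := by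
  have hn : l * k ≤ n := (Nat.le_div_iff_mul_le (by omega)).1 hlk
  have hl1 : 1 ≤ l := by omega
  have hT : (l - 1) * k + k = l * k := by
    obtain ⟨l, rfl⟩ := Nat.exists_eq_add_of_le' hl1
    simp [add_mul]
  obtain ⟨D, m, x, b, a, hP, -⟩ := DynRing.placedAt_final (missing := missing) (root := root)
    hk hl1 hlabel hn
  have hfin (t : ℕ) (ht : (l - 1) * k ≤ t) : DynRing.exec k label missing root t =
      DynRing.exec k label missing root ((l - 1) * k) := DynRing.exec_final hk hl1 hlabel hn ht
  refine ⟨⟨(l - 1) * k, le_refl _, hP.isTarget hn, hP.solvesDkD hn hl, fun t ht r => ?_⟩,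
    by omega, fun t hnc hnt => ?_⟩
  · rw [hfin t ht]
    exact ⟨hP.action_eq_none hn r, rfl⟩
  · have htT : t < (l - 1) * k := by
      by_contra! ht
      rw [hfin t ht] at hnt
      exact hnt (hP.isTarget hn)
    obtain ⟨c, j, h⟩ := DynRing.exists_placedAt (missing := missing) (root := root)
      hk hl1 hlabel hn t htT.le
    obtain ⟨h1, h2, h3, h4⟩ := h.time
    have hj : j < k := by
      by_contra hj
      obtain rfl : j = k := by omega
      rcases h.isChainConfig_or_isTarget hn with h | h
      · exact hnc h
      · exact hnt h
    obtain ⟨hC, hN⟩ := h.existsUnique_blocks hn hj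
    have h5 := Nat.mul_le_mul_right k h2
    -- The short gap lacks `k - j` edges and grows by one each round; `1 ≤ j` gives the bound `k -
    -- 1`.
    refine ⟨hC, hN, t + (k - j), by omega, by omega, ?_⟩
    obtain ⟨c', j', h'⟩ := DynRing.exists_placedAt (missing := missing) (root := root)
      hk hl1 hlabel hn (t + (k - j)) (by omega)
    obtain ⟨h1', h2', h3', h4'⟩ := h'.time
    obtain rfl : j' = k := by
      -- Comparing the time equations at `t` and `t + (k - j)` modulo `k` shows that `k` divides `k
      -- - j'`, which is less than `k`.
      obtain ⟨d, hd⟩ : k ∣ k - j' := by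
        have hd1 : k ∣ t + (k - j) + (k - j') + c' * k := h1' ▸ Dvd.intro_left l rfl
        have hd2 : k ∣ t + (k - j) + c * k := h1 ▸ Dvd.intro_left l rfl
        rw [Nat.dvd_add_left (Dvd.intro_left c' rfl)] at hd1
        rw [Nat.dvd_add_left (Dvd.intro_left c rfl)] at hd2
        exact (Nat.dvd_add_right hd2).1 hd1
      cases d with
      | zero => omega
      | succ d => rw [mul_add] at hd; omega
    exact h'.isChainConfig_or_isTarget hn
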